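/- Let $p\ge 1$ be an integer, $0<\alpha<2$, and $s_{12}(x)=\dfrac{x_1x_2}{|x|^{2+\alpha}}$ for $x\in\mathbb{R}^2\setminus\{0\}$, where $|\cdot|$ is the Euclidean norm. For $h>0$ and a compactly supported function $f$ let $$T_h^0[f]=h^2\sum_{\beta\in\mathbb{Z}^2\setminus\{0\}}f(\beta h)$$ be the punctured-hole trapezoidal rule. Put $$\mathcal I_p=\{(q-m,m): 2\le q\le p,\ 1\le m\le\lfloor q/2\rfloor\},\qquad N_p=|\mathcal I_p|$$ (so $\mathcal I_1=\emptyset$), and for $\gamma=(a,b)\in\mathcal I_p$ let $\mathcal G_\gamma\subset\mathbb{Z}^2$ be the set of all points $(\pm a,\pm b)$, $(\pm b,\pm a)$, with all choices of signs. Let $g\in C_c^\infty(\mathbb{R}^2)$ be real-valued and radially symmetric with $g(0)=1$ and $\partial^k g(0)=0$ for all multi-indices $k$ with $1\le|k|_1\le 2p-1$. For $h>0$ consider the linear system $\boldsymbol K\boldsymbol G(h)\,\omega(h)=c(h)$ for $\omega(h)\in\mathbb{R}^{N_p}$, with rows and columns indexed by $\mathcal I_p$, where $$K_{\xi,\gamma}=\sum_{\beta\in\mathcal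 G_\gamma}\operatorname{sgn}(\beta_1\beta_2)\,\beta_1^{2\xi_1-1}\beta_2^{2\xi_2-1},\qquad \boldsymbol G(h)=\operatorname{diag}\big(g(\gamma h)\big)_{\gamma\in\mathcal I_p},$$ $$c_\xi(h)=\frac{1}{h^{2(\xi_1+\xi_2)-\alpha}}\left(\int_{\mathbb{R}^2}g\,s_{12}\,x_1^{2\xi_1-1}x_2^{2\xi_2-1}\,dx-T_h^0\big[g\,s_{12}\,x_1^{2\xi_1-1}x_2^{2\xi_2-1}\big]\right).$$ Then for all sufficiently small $h>0$ the system has exactly one solution $\omega(h)$, and there is $\bar\omega\in\mathbb{R}^{N_p}$ such that $\omega(h)\to\bar\omega$ as $h\to0^+$, with $$|\omega(h)-\bar\omega|_2=O(h^{2p})\qquad(h\to0^+).$$ Moreover, for every real-valued $\phi\in C_c^N(\mathbb{R}^2)$ with $N\ge 2p+2$, the function $f=\phi\,s_{12}$ is integrable on $\mathbb{R}^2$, and the corrected trapezoidal rule $$Q_h^p[f]=T_h^0[f]+h^{2-\alpha}\sum_{\gamma\in\mathcal I_p}\bar\omega_\gamma\sum_{\beta\in\mathcal G_\gamma}\operatorname{sgn}(\beta_1\beta_2)\,\phi(\beta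 h)$$ (which is $T_h^0[f]$ when $p=1$) satisfies, for some constant $C>0$ independent of $h$, $$\left|Q_h^p[f]-\int_{\mathbb{R}^2}f(x)\,dx\right|\le C\,h^{2p+2-\alpha}\qquad\text{for all }h>0.$$ -/

import Mathlib

open Filter Topology MeasureTheory
open scoped ContDiff Matrix

noncomputable section

namespace OffDiag

/-- The Euclidean plane `ℝ²`; its norm is the Euclidean norm `|x|`. -/
abbrev Plane : Type := EuclideanSpace ℝ (Fin 2)

/-- The grid point `β h` for `β ∈ ℤ²` and mesh size `h`. -/
def gridPt (h : ℝ) (β : ℤ × ℤ) : Plane := !₂[(β.1 : ℝ) * h, (β.2 : ℝ) * h]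

/-- The off-diagonal singular kernel `s₁₂(x) = x₁ x₂ / |x|^(2+α)` on `ℝ²`
(its value at the origin, here `0`, is never used). -/
def kernel (α : ℝ) (x : Plane) : ℝ := x 0 * x 1 / ‖x‖ ^ (2 + α)

/-- The punctured-hole trapezoidal rule `T_h^0[f] = h² ∑_{β ∈ ℤ² ∖ {0}} f(β h)`.
For compactly supported `f` and `h > 0` the sum has finitely many nonzero terms. -/
def punctured (h : ℝ) (f : Plane → ℝ) : ℝ :=
  h ^ 2 * ∑' β : {β : ℤ × ℤ // β ≠ 0}, f (gridPt h β)

/-- The index set `I_p = {(q - m, m) : 2 ≤ q ≤ p, 1 ≤ m ≤ ⌊q/2⌋}`; it is empty for `p = 1`. -/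
def idx (p : ℕ) : Finset (ℕ × ℕ) :=
  (Finset.Icc 2 p).biUnion fun q => (Finset.Icc 1 (q / 2)).image fun m => (q - m, m)

/-- The set `G_γ` of all grid indices obtained from `γ = (a, b)` by changing signs and swapping
the coordinates: a set of eight points if `a ≠ b` and of four points if `a = b`. -/
def orbit (γ : ℕ × ℕ) : Finset (ℤ × ℤ) :=
  let a : ℤ := γ.1
  let b : ℤ := γ.2
  {(a, b), (-a, -b), (-a, b), (a, -b), (b, a), (-b, -a), (-b, a), (b, -a)}

/-- The sign `sgn(β₁ β₂)`. -/
def sgn (β : ℤ × ℤ) : ℝ := ((β.1 * β.2).sign : ℝ)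

/-- The coefficient matrix `K_{ξ,γ} = ∑_{β ∈ G_γ} sgn(β₁β₂) β^{2ξ - e₁ - e₂}`.
The exponents `2ξ₁ - 1`, `2ξ₂ - 1` are positive since both entries of `ξ ∈ I_p` are. -/
def coeffK (p : ℕ) : Matrix (idx p) (idx p) ℝ := fun ξ γ =>
  ∑ β ∈ orbit γ.1,
    sgn β * ((β.1 : ℝ) ^ (2 * ξ.1.1 - 1) * (β.2 : ℝ) ^ (2 * ξ.1.2 - 1))

/-- The diagonal matrix `G(h)` with entries `g(β h)`, `β ∈ G_γ`. For radially symmetric `g` this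
does not depend on the choice of `β ∈ G_γ`, and `β = γ` is taken. -/
def diagG (p : ℕ) (g : Plane → ℝ) (h : ℝ) : Matrix (idx p) (idx p) ℝ :=
  Matrix.diagonal fun γ => g (gridPt h ((γ.1.1 : ℤ), (γ.1.2 : ℤ)))

/-- The function `g · s₁₂ · x^{2ξ - e₁ - e₂}`. -/
def moment (α : ℝ) (g : Plane → ℝ) (ξ : ℕ × ℕ) (x : Plane) : ℝ :=
  g x * kernel α x * (x 0 ^ (2 * ξ.1 - 1) * x 1 ^ (2 * ξ.2 - 1))

/-- The right-hand side
`c_ξ(h) = h^{-(2|ξ|₁ - α)} (∫ g s₁₂ x^{2ξ-e₁-e₂} dx - T_h^0[g s₁₂ x^{2ξ-e₁-e₂}])`. -/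
def rhs (p : ℕ) (α : ℝ) (g : Plane → ℝ) (h : ℝ) : idx p → ℝ := fun ξ =>
  1 / h ^ (2 * ((ξ.1.1 : ℝ) + (ξ.1.2 : ℝ)) - α) *
    ((∫ x, moment α g ξ.1 x) - punctured h (moment α g ξ.1))

/-- `w` solves the linear system `K G(h) w = c(h)` at mesh size `h`. -/
def Solves (p : ℕ) (α : ℝ) (g : Plane → ℝ) (h : ℝ) (w : EuclideanSpace ℝ (idx p)) : Prop :=
  (coeffK p * diagG p g h) *ᵥ w.ofLp = rhs p α g h

/-- The corrected trapezoidal rule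
`Q_h^p[φ s₁₂] = T_h^0[φ s₁₂] + h^{2-α} ∑_{γ ∈ I_p} w_γ ∑_{β ∈ G_γ} sgn(β₁β₂) φ(β h)`.
For `p = 1` the correction is an empty sum and the rule is `T_h^0[φ s₁₂]`. -/
def corrected (p : ℕ) (α : ℝ) (w : EuclideanSpace ℝ (idx p)) (φ : Plane → ℝ) (h : ℝ) : ℝ :=
  punctured h (fun x => φ x * kernel α x) +
    h ^ (2 - α) * ∑ γ : idx p, w γ * ∑ β ∈ orbit γ.1, sgn β * φ (gridPt h β)

end OffDiag

end

namespace OffDiag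

/-! Everything rests on one quadrature estimate. If `F` has compact support and, off the origin,
`k`-th derivatives of size `|x|^(s-k)` with `s > -2`, for `k` up to some `M > s + 2`, then the
punctured rule integrates `F` up to `O(h^(s+2))`, with a constant that sees the symbol bounds but
not the support (`exists_quadrature_bound`). After rescaling to the unit lattice and cutting off the
origin, this reduces to the smooth estimate `norm_tsum_sub_integral_le_of_iteratedFDeriv`.

Independence of the support makes the scaled errors `c(h)` converge: `g(hx) - g(h'x)` is a symbol of
order `2p` with constant `O(h^(2p) + h'^(2p))`, so `c(h)` is Cauchy as `h → 0`, with limit `c` and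
rate `h^(2p)` (`exists_scaled_error_limit`). The matrix `K` is invertible because a left null vector
would be a symmetric polynomial of low degree in `(x², y²)` vanishing on a triangular lattice
(`coeffK_det_ne_zero`). As `g(γh) = 1 + O(h^(2p))`, the weights `G(h)⁻¹ K⁻¹ c(h)` tend to `K⁻¹ c` at
the same rate.

For the error bound, write `φ = g P + R` with `P` the Taylor polynomial of degree below `2p` and `R`
vanishing to order `2p` (`exists_remainder_isSymbol`). Both the quadrature error and the correction
of `R` are `O(h^(2p+2-α))`. For `g` times a monomial, symmetry kills the error unless both exponents
are odd; up to a swap the surviving monomials are those indexed by `I_p`, and their leading errors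
are cancelled by `K ω̄ = c`. -/

theorem gridPt_eq_smul (h : ℝ) (β : ℤ × ℤ) : gridPt h β = h • gridPt 1 β := by
  ext i; fin_cases i <;> simp [gridPt, mul_comm]

@[simp] theorem gridPt_zero (h : ℝ) : gridPt h 0 = 0 := by
  ext i; fin_cases i <;> simp [gridPt]

theorem abs_coord_le_norm (x : Plane) (i : Fin 2) : |x i| ≤ ‖x‖ := by
  simpa using PiLp.norm_apply_le x i

theorem norm_plane_le (x : Plane) : ‖x‖ ≤ |x 0| + |x 1| := by
  rw [EuclideanSpace.norm_eq, Fin.sum_univ_two]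
  refine Real.sqrt_le_iff.2 ⟨by positivity, ?_⟩
  simp only [Real.norm_eq_abs]
  nlinarith [mul_nonneg (abs_nonneg (x 0)) (abs_nonneg (x 1))]

/-! ### Lattice sums of smooth functions against integrals -/

/-- The half-open unit square with lower left corner `β`. -/
def cell (β : ℤ × ℤ) : Set Plane := {x | (⌊x 0⌋, ⌊x 1⌋) = β}

theorem measurable_coord (i : Fin 2) : Measurable fun x : Plane => x i :=
  (EuclideanSpace.proj (𝕜 := ℝ) i).continuous.measurable

theorem measurableSet_cell (β : ℤ × ℤ) : MeasurableSet (cell β) :=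
  ((Int.measurable_floor.comp (measurable_coord 0)).prodMk
    (Int.measurable_floor.comp (measurable_coord 1))) (measurableSet_singleton β)

theorem norm_le_two_of_mem_cell {x : Plane} (hx : x ∈ cell 0) : ‖x‖ ≤ 2 := by
  obtain ⟨h0, h1⟩ := Prod.ext_iff.1 hx
  have h0 := Int.floor_eq_zero_iff.1 h0
  have h1 := Int.floor_eq_zero_iff.1 h1
  refine (norm_plane_le x).trans ?_
  rw [abs_of_nonneg h0.1, abs_of_nonneg h1.1]
  linarith [h0.2, h1.2]

theorem volume_cell_zero : volume (cell 0) = 1 := by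
  have : cell 0 = (MeasurableEquiv.toLp 2 (Fin 2 → ℝ)).symm ⁻¹'
      (Set.univ.pi fun _ => Set.Ico (0 : ℝ) 1) := by
    ext x
    simp only [cell, Set.mem_ofPred_eq, Prod.ext_iff, Prod.fst_zero, Prod.snd_zero,
      Int.floor_eq_zero_iff, Set.mem_preimage, Set.mem_univ_pi, Fin.forall_fin_two]
    rfl
  rw [this, (EuclideanSpace.volume_preserving_symm_measurableEquiv_toLp
    (Fin 2)).measure_preimage (MeasurableSet.univ_pi
      fun _ => measurableSet_Ico).nullMeasurableSet, Real.volume_pi_Ico]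
  simp

/-- Replaces lattice sums by finite sums over one index set, uniformly for shifts in a ball, so that
they can be integrated and differentiated term by term. -/
theorem exists_finset_vanish {E : Type*} [NormedAddCommGroup E] {H : Plane → E}
    (hH : HasCompactSupport H) (R : ℝ) :
    ∃ S : Finset (ℤ × ℤ), ∀ x : Plane, ‖x‖ ≤ R → ∀ β ∉ S, H (x + gridPt 1 β) = 0 := by
  obtain ⟨r, hr⟩ := hH.isCompact.isBounded.subset_closedBall (0 : Plane)
  obtain ⟨n, hn⟩ := exists_nat_ge (R + r)
  refine ⟨Finset.Icc (-n, -n) (n, n), fun x hx β hβ => ?_⟩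
  by_contra h0
  have hmem : ‖x + gridPt 1 β‖ ≤ r := by
    simpa using hr (subset_tsupport H h0)
  have hle : ‖gridPt 1 β‖ ≤ n := by
    have := norm_sub_le (x + gridPt 1 β) x
    rw [add_sub_cancel_left] at this
    linarith
  have h1 : |(β.1 : ℝ)| ≤ n := by simpa [gridPt] using (abs_coord_le_norm (gridPt 1 β) 0).trans hle
  have h2 : |(β.2 : ℝ)| ≤ n := by simpa [gridPt] using (abs_coord_le_norm (gridPt 1 β) 1).trans hle
  rw [abs_le] at h1 h2
  apply hβ
  rw [Finset.mem_Icc]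
  exact ⟨⟨by exact_mod_cast h1.1, by exact_mod_cast h2.1⟩,
    ⟨by exact_mod_cast h1.2, by exact_mod_cast h2.2⟩⟩

section

variable {E : Type*} [NormedAddCommGroup E] [NormedSpace ℝ E]

theorem setIntegral_cell (H : Plane → E) (β : ℤ × ℤ) :
    ∫ x in cell β, H x = ∫ x in cell 0, H (x + gridPt 1 β) := by
  have hpre : (fun x => x + gridPt 1 β) ⁻¹' cell β = cell 0 := by
    ext x
    simp [cell, gridPt, Prod.ext_iff]
  rw [← hpre, (measurePreserving_add_right volume (gridPt 1 β)).setIntegral_preimage_emb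
    (measurableEmbedding_addRight _)]

theorem hasSum_setIntegral_cell {H : Plane → E} (hH : Integrable H) :
    HasSum (fun β => ∫ x in cell 0, H (x + gridPt 1 β)) (∫ x, H x) := by
  have huniv : ⋃ β, cell β = Set.univ := by
    ext x; simp [cell]
  have hd : Pairwise (Function.onFun Disjoint cell) := by
    intro β γ hβγ
    refine Set.disjoint_left.2 fun x hx hx' => hβγ ?_
    exact hx.symm.trans hx'
  have := hasSum_integral_iUnion (f := H) (μ := volume) measurableSet_cell hd hH.integrableOn
  rw [huniv, setIntegral_univ] at this
  simpa only [← setIntegral_cell] using this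

/-- The integral of `H` is the mean over a unit cell of the shifted lattice sums, so it lies as
close to one of them as they lie to each other. -/
theorem norm_tsum_sub_integral_le [CompleteSpace E] {H : Plane → E} (hH : Continuous H)
    (hc : HasCompactSupport H) (t : Plane) (D : ℝ)
    (hD : ∀ τ ∈ cell 0, ‖∑' β, H (t + gridPt 1 β) - ∑' β, H (t + τ + gridPt 1 β)‖ ≤ D) :
    ‖∑' β, H (t + gridPt 1 β) - ∫ x, H x‖ ≤ D := by
  obtain ⟨S, hS⟩ := exists_finset_vanish hc (‖t‖ + 2)
  have hfin : ∀ τ ∈ cell 0, ∑' β, H (t + τ + gridPt 1 β) = ∑ β ∈ S, H (t + τ + gridPt 1 β) :=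
    fun τ hτ => tsum_eq_sum fun β hβ => hS _
      ((norm_add_le _ _).trans (by linarith [norm_le_two_of_mem_cell hτ])) β hβ
  have hcont : ∀ β, Continuous fun τ => H (t + τ + gridPt 1 β) := fun β =>
    hH.comp (by fun_prop)
  have hbdd : Bornology.IsBounded (cell 0) :=
    (Metric.isBounded_closedBall (x := (0 : Plane)) (r := 2)).subset
      fun x hx => by simpa using norm_le_two_of_mem_cell hx
  have hint : ∀ β, IntegrableOn (fun τ => H (t + τ + gridPt 1 β)) (cell 0) := fun β =>
    ((hcont β).continuousOn.integrableOn_compact hbdd.isCompact_closure).mono_set subset_closure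
  have hI : ∫ x, H x = ∫ τ in cell 0, ∑' β, H (t + τ + gridPt 1 β) := by
    rw [setIntegral_congr_fun (measurableSet_cell 0) hfin, integral_finsetSum _ fun β _ => hint β]
    have hs := hasSum_setIntegral_cell (H := fun x => H (t + x))
      ((hH.integrable_of_hasCompactSupport hc).comp_add_left t)
    rw [integral_add_left_eq_self H t] at hs
    simp only [← add_assoc] at hs
    refine hs.unique (hasSum_sum_of_ne_finset_zero fun β hβ => ?_)
    refine setIntegral_eq_zero_of_forall_eq_zero fun τ hτ => hS _
      ((norm_add_le _ _).trans (by linarith [norm_le_two_of_mem_cell hτ])) β hβ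
  have hcell : volume.real (cell 0) = 1 := by simp [Measure.real, volume_cell_zero]
  have hconst : ∑' β, H (t + gridPt 1 β) = ∫ _ in cell 0, ∑' β, H (t + gridPt 1 β) := by
    rw [setIntegral_const, hcell, one_smul]
  rw [hI, hconst, ← integral_sub]
  · simpa [hcell] using norm_setIntegral_le_of_norm_le_const (μ := volume)
      (by simp [volume_cell_zero]) hD
  · exact integrableOn_const (by simp [volume_cell_zero])
  · exact IntegrableOn.congr_fun (integrable_finsetSum S fun β _ => hint β)
      (fun τ hτ => (hfin τ hτ).symm) (measurableSet_cell 0)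

theorem integral_fderiv_eq_zero [CompleteSpace E] {H : Plane → E} (hH : ContDiff ℝ 1 H)
    (hc : HasCompactSupport H) : ∫ x, fderiv ℝ H x = 0 := by
  have hi : Integrable (fderiv ℝ H) :=
    (hH.continuous_fderiv one_ne_zero).integrable_of_hasCompactSupport (hc.fderiv ℝ)
  ext v
  rw [ContinuousLinearMap.integral_apply hi]
  -- Integration by parts against the constant function 1.
  have := integral_smul_fderiv_eq_neg_fderiv_smul_of_integrable (μ := volume)
    (f := fun _ : Plane => (1 : ℝ)) (g := H) (v := v) (by simp)
    (by simpa using hi.apply_continuousLinearMap v)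
    (by simpa using hH.continuous.integrable_of_hasCompactSupport hc)
    (fun _ _ => differentiableAt_const _) (fun x _ => hH.differentiable one_ne_zero x)
  simpa using this

end

/-- An elementary substitute for Poisson summation. The derivative of `H` has integral zero, so by
induction the periodised derivative is small, and the mean value inequality bounds the oscillation
of the periodised `H` over a cell. The target space `E` varies in the induction because `fderiv ℝ H`
takes values in a space of linear maps. -/
theorem norm_tsum_sub_integral_le_of_iteratedFDeriv (M : ℕ) :
    ∀ {E : Type} [NormedAddCommGroup E] [NormedSpace ℝ E] [CompleteSpace E] {H : Plane → E}
      (_ : ContDiff ℝ M H) (_ : HasCompactSupport H) (K : ℝ)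
      (_ : ∀ (t : Plane) (S : Finset (ℤ × ℤ)),
        ∑ β ∈ S, ‖iteratedFDeriv ℝ M H (t + gridPt 1 β)‖ ≤ K) (t : Plane),
      ‖∑' β, H (t + gridPt 1 β) - ∫ x, H x‖ ≤ 2 * 2 ^ (2 * M) * K := by
  induction M with
  | zero =>
    intro E _ _ _ H hH hc K hK t
    refine norm_tsum_sub_integral_le hH.continuous hc t _ fun τ _ => ?_
    have key : ∀ t : Plane, ‖∑' β, H (t + gridPt 1 β)‖ ≤ K := fun t => by
      obtain ⟨S, hS⟩ := exists_finset_vanish hc ‖t‖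
      rw [tsum_eq_sum (hS t le_rfl)]
      exact (norm_sum_le _ _).trans (by simpa using hK t S)
    refine (norm_sub_le _ _).trans ?_
    have := key t
    have := key (t + τ)
    norm_num
    linarith
  | succ M ih =>
    intro E _ _ _ H hH hc K hK t
    have h1 : ContDiff ℝ 1 H := hH.of_le (by exact_mod_cast Nat.le_add_left 1 M)
    have hd : ContDiff ℝ M (fderiv ℝ H) := hH.fderiv_right (by norm_cast)
    have hder := ih hd (hc.fderiv ℝ) K fun t S => by
      simpa only [norm_iteratedFDeriv_fderiv] using hK t S
    rw [integral_fderiv_eq_zero h1 hc] at hder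
    simp only [sub_zero] at hder
    refine norm_tsum_sub_integral_le hH.continuous hc t _ fun τ hτ => ?_
    obtain ⟨S₁, hS₁⟩ := exists_finset_vanish hc (‖t‖ + 2)
    obtain ⟨S₂, hS₂⟩ := exists_finset_vanish (hc.fderiv ℝ) (‖t‖ + 2)
    classical
    set S := S₁ ∪ S₂
    have hA : ∀ x : Plane, ‖x‖ ≤ ‖t‖ + 2 →
        ∑' β, H (x + gridPt 1 β) = ∑ β ∈ S, H (x + gridPt 1 β) := fun x hx =>
      tsum_eq_sum fun β hβ => hS₁ x hx β fun h => hβ (Finset.mem_union_left _ h)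
    have hA' : ∀ x : Plane, ‖x‖ ≤ ‖t‖ + 2 →
        ∑' β, fderiv ℝ H (x + gridPt 1 β) = ∑ β ∈ S, fderiv ℝ H (x + gridPt 1 β) := fun x hx =>
      tsum_eq_sum fun β hβ => hS₂ x hx β fun h => hβ (Finset.mem_union_right _ h)
    have ht : ‖t‖ ≤ ‖t‖ + 2 := by linarith
    have hτ2 := norm_le_two_of_mem_cell hτ
    have htτ : ‖t + τ‖ ≤ ‖t‖ + 2 := (norm_add_le _ _).trans (by linarith)
    rw [hA t ht, hA _ htτ]
    have hderiv : ∀ x ∈ Metric.closedBall (0 : Plane) (‖t‖ + 2),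
        HasFDerivWithinAt (fun x => ∑ β ∈ S, H (x + gridPt 1 β))
          (∑ β ∈ S, fderiv ℝ H (x + gridPt 1 β)) (Metric.closedBall (0 : Plane) (‖t‖ + 2)) x := by
      intro x _
      refine (HasFDerivAt.fun_sum fun β _ => ?_).hasFDerivWithinAt
      exact (hasFDerivAt_comp_add_right _).2 (h1.differentiable one_ne_zero _).hasFDerivAt
    have := (convex_closedBall (0 : Plane) (‖t‖ + 2)).norm_image_sub_le_of_norm_hasFDerivWithin_le
      hderiv (fun x hx => by rw [← hA' x (by simpa using hx)]; exact hder x)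
      (mem_closedBall_zero_iff.2 htτ) (mem_closedBall_zero_iff.2 ht)
    refine this.trans ?_
    have hK0 : 0 ≤ 2 * 2 ^ (2 * M) * K := by
      have := hK 0 ∅
      simp only [Finset.sum_empty] at this
      positivity
    rw [sub_add_cancel_left, norm_neg]
    -- Points of the cell have norm at most 2; the cruder 4 supplies the factor `2 ^ 2` of each
    -- induction step.
    calc 2 * 2 ^ (2 * M) * K * ‖τ‖ ≤ 2 * 2 ^ (2 * M) * K * 4 := by gcongr; linarith
      _ = _ := by ring

/-! ### Symbol classes at the origin -/

/-- `F` is `C^M` away from the origin, where its `k`-th derivative is at most `B |x|^(s - k)`,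
for `k ≤ M`. -/
structure IsSymbol (s : ℝ) (M : ℕ) (B : ℝ) (F : Plane → ℝ) : Prop where
  contDiffOn : ContDiffOn ℝ M F {0}ᶜ
  bound : ∀ k ≤ M, ∀ x ≠ 0, ‖iteratedFDeriv ℝ k F x‖ ≤ B * ‖x‖ ^ (s - k)

theorem isOpen_compl_zero : IsOpen ({0}ᶜ : Set Plane) := isOpen_compl_singleton

theorem exists_norm_eq_one : ∃ x : Plane, ‖x‖ = 1 :=
  ⟨EuclideanSpace.single 0 1, by simp⟩

namespace IsSymbol

variable {s t A B : ℝ} {M : ℕ} {F G : Plane → ℝ}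

theorem nonneg (hF : IsSymbol s M A F) : 0 ≤ A := by
  obtain ⟨x, hx⟩ := exists_norm_eq_one
  have := hF.bound 0 (Nat.zero_le _) x (fun h => by simp [h] at hx)
  rw [hx, Real.one_rpow, mul_one] at this
  exact (norm_nonneg _).trans this

theorem abs_le (hF : IsSymbol s M A F) {x : Plane} (hx : x ≠ 0) : |F x| ≤ A * ‖x‖ ^ s := by
  simpa using hF.bound 0 (Nat.zero_le _) x hx

/-- Leibniz's rule; the binomial coefficients sum to `2 ^ k ≤ 2 ^ M`. -/
theorem mul (hF : IsSymbol s M A F) (hG : IsSymbol t M B G) :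
    IsSymbol (s + t) M (2 ^ M * A * B) (fun x => F x * G x) := by
  refine ⟨hF.contDiffOn.mul hG.contDiffOn, fun k hk x hx => ?_⟩
  have hA := hF.nonneg
  have hB := hG.nonneg
  have hx0 : 0 < ‖x‖ := norm_pos_iff.2 hx
  have key := norm_iteratedFDerivWithin_mul_le hF.contDiffOn hG.contDiffOn
    isOpen_compl_zero.uniqueDiffOn (x := x) hx (n := k) (by exact_mod_cast hk)
  simp only [iteratedFDerivWithin_of_isOpen _ isOpen_compl_zero (Set.mem_compl_singleton_iff.2 hx)]
    at key
  refine key.trans ?_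
  calc _ ≤ ∑ i ∈ Finset.range (k + 1), (k.choose i : ℝ) * (A * B * ‖x‖ ^ (s + t - k)) := by
        refine Finset.sum_le_sum fun i hi => ?_
        have hik : i ≤ k := Nat.lt_succ_iff.1 (Finset.mem_range.1 hi)
        rw [mul_assoc]
        refine mul_le_mul_of_nonneg_left ?_ (Nat.cast_nonneg _)
        calc _ ≤ A * ‖x‖ ^ (s - i) * (B * ‖x‖ ^ (t - (k - i : ℕ))) := by
              gcongr
              · exact hF.bound i (hik.trans hk) x hx
              · exact hG.bound _ ((Nat.sub_le _ _).trans hk) x hx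
          _ = A * B * (‖x‖ ^ (s - i) * ‖x‖ ^ (t - (k - i : ℕ))) := by ring
          _ = _ := by
              rw [← Real.rpow_add hx0, Nat.cast_sub hik]
              ring_nf
    _ = 2 ^ k * (A * B * ‖x‖ ^ (s + t - k)) := by
        rw [← Finset.sum_mul]
        congr 1
        exact_mod_cast Nat.sum_range_choose k
    _ ≤ 2 ^ M * (A * B * ‖x‖ ^ (s + t - k)) := by
        gcongr
        norm_num
    _ = _ := by ring

theorem sub (hF : IsSymbol s M A F) (hG : IsSymbol s M B G) :
    IsSymbol s M (A + B) (fun x => F x - G x) := by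
  refine ⟨hF.contDiffOn.sub hG.contDiffOn, fun k hk x hx => ?_⟩
  have hn := isOpen_compl_zero.mem_nhds (Set.mem_compl_singleton_iff.2 hx)
  have hk' : (k : ℕ∞ω) ≤ M := by exact_mod_cast hk
  have : iteratedFDeriv ℝ k (fun x => F x - G x) x
      = iteratedFDeriv ℝ k F x - iteratedFDeriv ℝ k G x :=
    iteratedFDeriv_sub_apply ((hF.contDiffOn.contDiffAt hn).of_le hk')
      ((hG.contDiffOn.contDiffAt hn).of_le hk')
  rw [this, add_mul]
  exact (norm_sub_le _ _).trans (add_le_add (hF.bound k hk x hx) (hG.bound k hk x hx))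

end IsSymbol

theorem norm_iteratedFDeriv_comp_smul (F : Plane → ℝ) {c : ℝ} (hc : 0 < c) (k : ℕ) (x : Plane) :
    ‖iteratedFDeriv ℝ k (fun y => F (c • y)) x‖ = c ^ k * ‖iteratedFDeriv ℝ k F (c • x)‖ := by
  let e : Plane ≃L[ℝ] Plane := ContinuousLinearEquiv.smulLeft (Units.mk0 c hc.ne')
  have he : ∀ y, e y = c • y := fun y => rfl
  have h := e.iteratedFDerivWithin_comp_right F uniqueDiffOn_univ (Set.mem_univ (e x)) k
  rw [Set.preimage_univ, iteratedFDerivWithin_univ, iteratedFDerivWithin_univ] at h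
  have h2 : (iteratedFDeriv ℝ k F (e x)).compContinuousLinearMap (fun _ => (e : Plane →L[ℝ] Plane))
      = c ^ k • iteratedFDeriv ℝ k F (c • x) := by
    ext v
    simp only [ContinuousMultilinearMap.compContinuousLinearMap_apply,
      ContinuousLinearEquiv.coe_coe, he, _root_.smul_apply]
    rw [ContinuousMultilinearMap.map_smul_univ]
    simp
  rw [h2] at h
  have h3 : F ∘ e = fun y => F (c • y) := rfl
  rw [← h3, h, norm_smul, norm_pow, Real.norm_of_nonneg hc.le]

theorem IsSymbol.comp_smul {s B : ℝ} {M : ℕ} {F : Plane → ℝ} (hF : IsSymbol s M B F) {h : ℝ}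
    (hh : 0 < h) : IsSymbol s M (B * h ^ s) (fun x => F (h • x)) := by
  refine ⟨hF.contDiffOn.comp (contDiff_const_smul h).contDiffOn fun x hx => ?_,
    fun k hk x hx => ?_⟩
  · exact smul_ne_zero hh.ne' hx
  · rw [norm_iteratedFDeriv_comp_smul F hh]
    have := hF.bound k hk (h • x) (smul_ne_zero hh.ne' hx)
    rw [norm_smul, Real.norm_of_nonneg hh.le, Real.mul_rpow hh.le (norm_nonneg _)] at this
    calc _ ≤ h ^ k * (B * (h ^ (s - k) * ‖x‖ ^ (s - k))) := by gcongr
      _ = B * (h ^ (s - k) * h ^ (k : ℝ)) * ‖x‖ ^ (s - k) := by rw [Real.rpow_natCast]; ring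
      _ = _ := by rw [← Real.rpow_add hh]; ring_nf

/-- Derivatives are bounded on the unit circle by compactness, and homogeneity carries the bounds to
every other radius. -/
theorem exists_isSymbol_of_homogeneous {d : ℝ} {F : Plane → ℝ} (hF : ContDiffOn ℝ ∞ F {0}ᶜ)
    (hom : ∀ c : ℝ, 0 < c → ∀ x, F (c • x) = c ^ d * F x) (M : ℕ) :
    ∃ B, IsSymbol d M B F := by
  have hS : IsCompact (Metric.sphere (0 : Plane) 1) := isCompact_sphere 0 1
  have hsub : Metric.sphere (0 : Plane) 1 ⊆ {0}ᶜ := fun x hx h => by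
    rw [Set.mem_singleton_iff] at h
    simp [h] at hx
  have hbd : ∀ k : ℕ, ∃ B, ∀ x : Plane, ‖x‖ = 1 → ‖iteratedFDeriv ℝ k F x‖ ≤ B := by
    intro k
    have hc : ContinuousOn (iteratedFDeriv ℝ k F) {0}ᶜ :=
      (hF.continuousOn_iteratedFDerivWithin (m := k) (by exact_mod_cast le_top)
        isOpen_compl_zero.uniqueDiffOn).congr
        fun x hx => (iteratedFDerivWithin_of_isOpen _ isOpen_compl_zero hx).symm
    obtain ⟨B, hB⟩ := hS.exists_bound_of_continuousOn (hc.mono hsub)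
    exact ⟨B, fun x hx => hB x (by simpa using hx)⟩
  choose B hB using hbd
  have hB0 : ∀ k, 0 ≤ B k := fun k => by
    obtain ⟨x, hx⟩ := exists_norm_eq_one
    exact (norm_nonneg _).trans (hB k x hx)
  refine ⟨∑ k ∈ Finset.range (M + 1), B k, hF.of_le (by exact_mod_cast le_top),
    fun k hk x hx => ?_⟩
  have hx0 : 0 < ‖x‖ := norm_pos_iff.2 hx
  have hx1 : ‖‖x‖⁻¹ • x‖ = 1 := by rw [norm_smul, norm_inv, norm_norm, inv_mul_cancel₀ hx0.ne']
  have h1 := norm_iteratedFDeriv_comp_smul F hx0 k (‖x‖⁻¹ • x)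
  rw [smul_inv_smul₀ hx0.ne'] at h1
  have hn := isOpen_compl_zero.mem_nhds (hsub (mem_sphere_zero_iff_norm.2 hx1))
  have h2 : iteratedFDeriv ℝ k (fun y => F (‖x‖ • y)) (‖x‖⁻¹ • x)
      = ‖x‖ ^ d • iteratedFDeriv ℝ k F (‖x‖⁻¹ • x) := by
    rw [funext (hom ‖x‖ hx0)]
    have hFk : ContDiffAt ℝ k F (‖x‖⁻¹ • x) :=
      (hF.contDiffAt hn).of_le (by exact_mod_cast le_top)
    exact iteratedFDeriv_const_smul_apply' (a := ‖x‖ ^ d) hFk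
  rw [h2, norm_smul, Real.norm_of_nonneg (Real.rpow_nonneg hx0.le d)] at h1
  have h3 : ‖iteratedFDeriv ℝ k F x‖ = ‖x‖ ^ (d - k) * ‖iteratedFDeriv ℝ k F (‖x‖⁻¹ • x)‖ := by
    rw [Real.rpow_sub hx0, Real.rpow_natCast, div_mul_eq_mul_div, h1]
    field_simp
  rw [h3, mul_comm]
  gcongr
  exact (hB k _ hx1).trans (Finset.single_le_sum (fun i _ => hB0 i) (by simpa using by omega))

/-- Derivatives of order at most `n` are controlled by descending from order `n` with the mean value
inequality. Above order `n` the power `‖x‖ ^ (n - k)` is bounded below on a ball, and outside it the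
derivative is zero. With `n = 0` the vanishing hypothesis is empty. -/
theorem exists_isSymbol_of_vanish {n M : ℕ} (hnM : n ≤ M) {u : Plane → ℝ} (hu : ContDiff ℝ M u)
    {c R : ℝ} (hc : ∀ x, R ≤ ‖x‖ → u x = c) (h0 : ∀ j < n, iteratedFDeriv ℝ j u 0 = 0) :
    ∃ B, IsSymbol n M B u := by
  have hout : ∀ (k : ℕ) (x : Plane), R < ‖x‖ →
      iteratedFDeriv ℝ k u x = iteratedFDeriv ℝ k (fun _ : Plane => c) x := by
    intro k x hx
    have : u =ᶠ[𝓝 x] fun _ => c := by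
      filter_upwards [continuous_norm.continuousAt.eventually_const_lt hx] with y hy
      exact hc y hy.le
    exact (this.iteratedFDeriv ℝ k).eq_of_nhds
  have hbd : ∀ k : ℕ, ∃ B, 0 ≤ B ∧ (k ≤ M → ∀ x : Plane, ‖iteratedFDeriv ℝ k u x‖ ≤ B) := by
    intro k
    by_cases hk : k ≤ M
    swap
    · exact ⟨0, le_rfl, fun h => absurd h hk⟩
    obtain ⟨B, hB⟩ := (isCompact_closedBall (0 : Plane) R).exists_bound_of_continuousOn
      (hu.continuous_iteratedFDeriv (m := k) (by exact_mod_cast hk)).continuousOn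
    refine ⟨max B |c|, le_max_of_le_right (abs_nonneg _), fun _ x => ?_⟩
    rcases le_or_gt ‖x‖ R with hx | hx
    · exact (hB x (by simpa using hx)).trans (le_max_left _ _)
    · refine le_trans ?_ (le_max_right _ _)
      rw [hout k x hx]
      rcases Nat.eq_zero_or_pos k with rfl | hk0
      · simp
      · rw [iteratedFDeriv_const_of_ne hk0.ne']
        simp
  choose B hB0 hB using hbd
  have hlow : ∀ m ≤ n, ∀ x : Plane, ‖iteratedFDeriv ℝ (n - m) u x‖ ≤ B n * ‖x‖ ^ m := by
    intro m
    induction m with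
    | zero => intro _ x; simpa using hB n hnM x
    | succ m ih =>
      intro hm x
      have hd : Differentiable ℝ (iteratedFDeriv ℝ (n - (m + 1)) u) :=
        hu.differentiable_iteratedFDeriv (by exact_mod_cast (by omega : n - (m + 1) < M))
      have hmv := (convex_closedBall (0 : Plane) ‖x‖).norm_image_sub_le_of_norm_fderiv_le
        (f := iteratedFDeriv ℝ (n - (m + 1)) u) (C := B n * ‖x‖ ^ m) (x := 0) (y := x)
        (fun y _ => hd y) (fun y hy => by
          rw [norm_fderiv_iteratedFDeriv, show n - (m + 1) + 1 = n - m by omega]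
          refine (ih (by omega) y).trans ?_
          have : ‖y‖ ≤ ‖x‖ := by simpa using hy
          have := hB0 n
          gcongr) (by simp) (by simp)
      rw [h0 _ (by omega), sub_zero, sub_zero] at hmv
      rwa [pow_succ, ← mul_assoc]
  set R' := |R| + 1
  have hR' : 1 ≤ R' := by simp [R']
  refine ⟨∑ k ∈ Finset.range (M + 1), B k * R' ^ M, hu.contDiffOn, fun k hk x hx => ?_⟩
  have hx0 : 0 < ‖x‖ := norm_pos_iff.2 hx
  have hsingle : ∀ k ≤ M, B k * R' ^ M ≤ ∑ k ∈ Finset.range (M + 1), B k * R' ^ M := fun k hk =>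
    Finset.single_le_sum (f := fun k => B k * R' ^ M)
      (fun i _ => mul_nonneg (hB0 i) (by positivity)) (by simpa using by omega)
  rcases le_or_gt k n with hkn | hkn
  · have := hlow (n - k) (Nat.sub_le _ _) x
    rw [Nat.sub_sub_self hkn, ← Real.rpow_natCast, Nat.cast_sub hkn] at this
    refine this.trans ?_
    gcongr
    refine le_trans ?_ (hsingle n hnM)
    exact le_mul_of_one_le_right (hB0 n) (one_le_pow₀ hR')
  · rcases le_or_gt ‖x‖ R' with hxR | hxR
    · calc _ ≤ B k := hB k hk x
        _ = B k * (‖x‖ ^ ((k : ℝ) - n) * ‖x‖ ^ ((n : ℝ) - k)) := by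
            rw [← Real.rpow_add hx0]; simp
        _ ≤ B k * (R' ^ M * ‖x‖ ^ ((n : ℝ) - k)) := by
            have := hB0 k
            gcongr
            rw [← Nat.cast_sub hkn.le, Real.rpow_natCast]
            calc _ ≤ R' ^ (k - n) := by gcongr
              _ ≤ R' ^ M := pow_le_pow_right₀ hR' (by omega)
        _ = B k * R' ^ M * ‖x‖ ^ ((n : ℝ) - k) := by ring
        _ ≤ _ := by gcongr; exact hsingle k hk
    · rw [hout k x (by linarith [le_abs_self R]), iteratedFDeriv_const_of_ne (by omega)]
      simp only [Pi.zero_apply, norm_zero]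
      exact mul_nonneg (Finset.sum_nonneg fun i _ => mul_nonneg (hB0 i) (by positivity))
        (Real.rpow_nonneg hx0.le _)

/-! ### The punctured rule for singular symbols -/

theorem integrableOn_ball_norm_rpow {s : ℝ} (hs : -2 < s) (r : ℝ) :
    IntegrableOn (fun x : Plane => ‖x‖ ^ s) (Metric.ball 0 r) := by
  rcases le_or_gt r 0 with hr | hr
  · rw [Metric.ball_eq_empty.2 hr]; exact integrableOn_empty
  refine (integrableOn_fun_norm_addHaar volume (f := fun y => y ^ s)).2 ?_
  refine ((intervalIntegral.integrableOn_Ioo_rpow_iff (s := s + 1) hr).2 (by linarith)).congr_fun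
    (fun y hy => ?_) measurableSet_Ioo
  have : y ^ (s + 1) = y ^ s * y := by rw [Real.rpow_add hy.1, Real.rpow_one]
  simp [this, mul_comm]

theorem IsSymbol.integrable {s B : ℝ} {M : ℕ} {G : Plane → ℝ} (hs : -2 < s)
    (hG : IsSymbol s M B G) (hc : HasCompactSupport G) : Integrable G := by
  have hmeas : AEStronglyMeasurable G volume := by
    have := hG.contDiffOn.continuousOn.aestronglyMeasurable (μ := volume)
      isOpen_compl_zero.measurableSet
    rwa [restrict_compl_singleton] at this
  obtain ⟨r, hr⟩ := hc.isCompact.isBounded.subset_ball (0 : Plane)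
  rw [← integrableOn_iff_integrable_of_support_subset ((subset_tsupport G).trans hr)]
  refine ((integrableOn_ball_norm_rpow hs r).const_mul B).mono' hmeas.restrict ?_
  refine ae_restrict_of_ae ?_
  filter_upwards [Measure.ae_ne volume (0 : Plane)] with x hx
  exact hG.abs_le hx

/-- Uniformity in `t` comes from reindexing the lattice by the integer part of `t`, which leaves a
shift of bounded size; the series is then dominated by an Eisenstein-type sum. -/
theorem exists_lattice_sum_bound {r : ℝ} (hr : 2 < r) :
    ∃ K : ℝ, ∀ (t : Plane) (S : Finset (ℤ × ℤ)),
      ∑ β ∈ S, (1 + ‖t + gridPt 1 β‖) ^ (-r) ≤ K := by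
  classical
  -- At `m = 0` the power is `0 ^ (-r) = 0` by convention, so the origin needs its own term 1.
  let f : (Fin 2 → ℤ) → ℝ := fun m => ‖m‖ ^ (-r) + if m = 0 then 1 else 0
  have hf : Summable f := by
    refine (EisensteinSeries.summable_one_div_norm_rpow hr).add ?_
    exact (hasSum_ite_eq (0 : Fin 2 → ℤ) (1 : ℝ)).summable
  have hf0 : ∀ m, 0 ≤ f m := fun m => by
    have := Real.rpow_nonneg (norm_nonneg m) (-r)
    simp only [f]
    split_ifs <;> linarith
  refine ⟨∑' m, f m, fun t S => ?_⟩
  let e : ℤ × ℤ → (Fin 2 → ℤ) := fun β => ![⌊t 0⌋ + β.1, ⌊t 1⌋ + β.2]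
  have he : Function.Injective e := by
    intro β γ h
    have h0 := congrFun h 0
    have h1 := congrFun h 1
    simp only [e, Matrix.cons_val_zero, Matrix.cons_val_one, add_right_inj] at h0 h1
    exact Prod.ext h0 h1
  have hle : ∀ β, (1 + ‖t + gridPt 1 β‖) ^ (-r) ≤ f (e β) := by
    intro β
    have hfl : ∀ (y : ℝ) (m : ℤ), |((⌊y⌋ + m : ℤ) : ℝ)| ≤ 1 + |y + m| := by
      intro y m
      have h1 := Int.floor_le y
      have h2 := (Int.lt_floor_add_one y).le
      push_cast
      have : (⌊y⌋ : ℝ) + m = (y + m) - (y - ⌊y⌋) := by ring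
      rw [this]
      refine (abs_sub _ _).trans ?_
      rw [abs_of_nonneg (sub_nonneg.2 h1)]
      linarith
    have hnorm : ‖e β‖ ≤ 1 + ‖t + gridPt 1 β‖ := by
      refine (pi_norm_le_iff_of_nonneg (by positivity)).2 fun i => ?_
      have hi := abs_coord_le_norm (t + gridPt 1 β) i
      fin_cases i
      · refine (hfl (t 0) β.1).trans ?_
        simpa [gridPt] using hi
      · refine (hfl (t 1) β.2).trans ?_
        simpa [gridPt] using hi
    by_cases h0 : e β = 0
    · refine (Real.rpow_le_one_of_one_le_of_nonpos ?_ (by linarith)).trans ?_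
      · linarith [norm_nonneg (t + gridPt 1 β)]
      · simp only [f, h0, norm_zero, if_true]
        linarith [Real.rpow_nonneg (le_refl (0 : ℝ)) (-r)]
    · simp only [f, if_neg h0, add_zero]
      exact Real.rpow_le_rpow_of_nonpos (norm_pos_iff.2 h0) hnorm (by linarith)
  calc _ ≤ ∑ β ∈ S, f (e β) := Finset.sum_le_sum fun β _ => hle β
    _ = ∑ m ∈ S.image e, f m := (Finset.sum_image fun _ _ _ _ h => he h).symm
    _ ≤ _ := hf.sum_le_tsum _ fun m _ => hf0 m

theorem exists_cutoff : ∃ η : Plane → ℝ, ContDiff ℝ ∞ η ∧ (∀ x, ‖x‖ ≤ 1 / 4 → η x = 0) ∧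
    (∀ x, 1 / 2 ≤ ‖x‖ → η x = 1) ∧ ∀ x, |1 - η x| ≤ 1 := by
  let χ : ContDiffBump (0 : Plane) := ⟨1 / 4, 1 / 2, by norm_num, by norm_num⟩
  refine ⟨fun x => 1 - χ x, contDiff_const.sub χ.contDiff, fun x hx => ?_, fun x hx => ?_,
    fun x => ?_⟩
  · have h1 : χ x = 1 := χ.one_of_mem_closedBall (mem_closedBall_zero_iff.2 hx)
    simp [h1]
  · have h0 : χ x = 0 := χ.zero_of_le_dist (by rwa [dist_zero_right])
    simp [h0]
  · rw [sub_sub_cancel, abs_of_nonneg χ.nonneg]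
    exact χ.le_one

theorem one_le_norm_gridPt {β : ℤ × ℤ} (hβ : β ≠ 0) : 1 ≤ ‖gridPt 1 β‖ := by
  by_cases h0 : β.1 = 0
  · have h1 : β.2 ≠ 0 := fun h1 => hβ (Prod.ext h0 h1)
    refine le_trans ?_ (abs_coord_le_norm _ 1)
    simpa [gridPt] using (by exact_mod_cast Int.one_le_abs h1 : (1 : ℝ) ≤ |(β.2 : ℝ)|)
  · refine le_trans ?_ (abs_coord_le_norm _ 0)
    simpa [gridPt] using (by exact_mod_cast Int.one_le_abs h0 : (1 : ℝ) ≤ |(β.1 : ℝ)|)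

/-- On the unit lattice, the punctured sum approximates the integral with an error that depends on
the symbol bounds only, and not on the size of the support. -/
theorem exists_lattice_quadrature_bound {s : ℝ} {M : ℕ} (hs : -2 < s) (hM : s + 2 < M) :
    ∃ C : ℝ, 0 ≤ C ∧ ∀ (B : ℝ) (G : Plane → ℝ), IsSymbol s M B G → HasCompactSupport G →
      |∑' β : {β : ℤ × ℤ // β ≠ 0}, G (gridPt 1 β) - ∫ x, G x| ≤ C * B := by
  obtain ⟨η, hη, hη0, hη1, hηle⟩ := exists_cutoff
  obtain ⟨A, hA⟩ := exists_isSymbol_of_vanish (n := 0) (Nat.zero_le M)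
    (hη.of_le (by exact_mod_cast le_top)) hη1 (by simp)
  obtain ⟨K, hK⟩ := exists_lattice_sum_bound (r := M - s) (by linarith)
  have hA0 := hA.nonneg
  have hK0 : 0 ≤ K := by simpa using hK 0 ∅
  have hI0 : 0 ≤ ∫ x in Metric.ball (0 : Plane) 1, ‖x‖ ^ s :=
    setIntegral_nonneg measurableSet_ball fun x _ => by positivity
  refine ⟨2 * 2 ^ (2 * M) * (2 ^ M * A * 5 ^ ((M : ℝ) - s) * K) +
    ∫ x in Metric.ball (0 : Plane) 1, ‖x‖ ^ s, by positivity, fun B G hG hc => ?_⟩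
  have hB0 := hG.nonneg
  -- The cutoff removes the singularity without touching any nonzero lattice point, so the full sum
  -- of `H` is the punctured sum of `G`. The integrals differ only over the unit ball, where `‖x‖ ^
  -- s` is integrable.
  set H : Plane → ℝ := fun x => η x * G x
  have hHs : IsSymbol s M (2 ^ M * A * B) H := by simpa using hA.mul hG
  have hHnear : ∀ x : Plane, ‖x‖ < 1 / 4 → H =ᶠ[𝓝 x] fun _ => 0 := fun x hx => by
    filter_upwards [continuous_norm.continuousAt.eventually_lt_const hx] with y hy
    simp [H, hη0 y hy.le]
  have hHd : ContDiff ℝ M H := by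
    refine contDiff_iff_contDiffAt.2 fun x => ?_
    by_cases hx : x = 0
    · subst hx
      exact contDiffAt_const.congr_of_eventuallyEq (hHnear 0 (by norm_num))
    · exact hHs.contDiffOn.contDiffAt (isOpen_compl_zero.mem_nhds hx)
  have hHc : HasCompactSupport H := hc.mul_left
  have hD : ∀ x, ‖iteratedFDeriv ℝ M H x‖ ≤
      2 ^ M * A * B * 5 ^ ((M : ℝ) - s) * (1 + ‖x‖) ^ (-((M : ℝ) - s)) := by
    intro x
    rcases lt_or_ge ‖x‖ (1 / 4) with hx | hx
    · have : iteratedFDeriv ℝ M H x = 0 := by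
        rw [((hHnear x hx).iteratedFDeriv ℝ M).eq_of_nhds]
        simp
      rw [this, norm_zero]
      positivity
    · have hx0 : 0 < ‖x‖ := by linarith
      refine (hHs.bound M le_rfl x (norm_pos_iff.1 hx0)).trans ?_
      rw [mul_assoc (2 ^ M * A * B)]
      gcongr
      rw [neg_sub]
      -- The 5 comes from `‖x‖ ≥ 1/4`, which gives `1 + ‖x‖ ≤ 5 ‖x‖`; the exponent is negative.
      calc ‖x‖ ^ (s - M) ≤ ((1 + ‖x‖) / 5) ^ (s - M) :=
            Real.rpow_le_rpow_of_nonpos (by positivity) (by linarith) (by linarith)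
        _ = _ := by
            rw [Real.div_rpow (by positivity) (by norm_num), div_eq_mul_inv,
              ← Real.rpow_neg (by norm_num), neg_sub, mul_comm]
  have hper := norm_tsum_sub_integral_le_of_iteratedFDeriv M hHd hHc
    (2 ^ M * A * B * 5 ^ ((M : ℝ) - s) * K) (fun t S => by
      refine (Finset.sum_le_sum fun β _ => hD (t + gridPt 1 β)).trans ?_
      rw [← Finset.mul_sum]
      gcongr
      exact hK t S) 0
  have hsum : ∑' β, H (0 + gridPt 1 β) = ∑' β : {β : ℤ × ℤ // β ≠ 0}, G (gridPt 1 β) := by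
    have hsupp : Function.support (fun β => H (0 + gridPt 1 β)) ⊆ {β : ℤ × ℤ | β ≠ 0} := by
      intro β hβ h0
      subst h0
      exact hβ (by simp [H, hη0])
    rw [← tsum_subtype_eq_of_support_subset hsupp]
    refine tsum_congr fun β => ?_
    have := one_le_norm_gridPt β.2
    simp [H, hη1 (gridPt 1 β) (by linarith)]
  have hdiff : |(∫ x, H x) - ∫ x, G x| ≤ (∫ x in Metric.ball (0 : Plane) 1, ‖x‖ ^ s) * B := by
    rw [← integral_sub (hHs.integrable hs hHc) (hG.integrable hs hc),
      ← integral_indicator measurableSet_ball, ← integral_mul_const]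
    refine norm_integral_le_of_norm_le (f := fun x => H x - G x) (Integrable.mul_const
      ((integrable_indicator_iff measurableSet_ball).2 (integrableOn_ball_norm_rpow hs 1)) B) ?_
    filter_upwards [Measure.ae_ne volume (0 : Plane)] with x hx
    by_cases hx1 : x ∈ Metric.ball (0 : Plane) 1
    · rw [Set.indicator_of_mem hx1]
      calc ‖H x - G x‖ = |1 - η x| * |G x| := by
            rw [← abs_mul, Real.norm_eq_abs, ← abs_neg]
            congr 1
            simp only [H]
            ring
        _ ≤ 1 * (B * ‖x‖ ^ s) := by
            gcongr
            · exact hηle x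
            · exact hG.abs_le hx
        _ = _ := by ring
    · rw [Set.indicator_of_notMem hx1]
      have : 1 ≤ ‖x‖ := by simpa using hx1
      simp [H, hη1 x (by linarith)]
  rw [hsum] at hper
  calc _ ≤ |∑' β : {β : ℤ × ℤ // β ≠ 0}, G (gridPt 1 β) - ∫ x, H x| + |(∫ x, H x) - ∫ x, G x| :=
        abs_sub_le _ _ _
    _ ≤ 2 * 2 ^ (2 * M) * (2 ^ M * A * B * 5 ^ ((M : ℝ) - s) * K) +
          (∫ x in Metric.ball (0 : Plane) 1, ‖x‖ ^ s) * B := add_le_add hper hdiff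
    _ = _ := by ring

theorem punctured_sub_integral {h : ℝ} (hh : 0 < h) (F : Plane → ℝ) :
    punctured h F - ∫ x, F x =
      h ^ 2 * (∑' β : {β : ℤ × ℤ // β ≠ 0}, F (h • gridPt 1 β) - ∫ x, F (h • x)) := by
  have : ∫ x, F (h • x) = (h ^ 2)⁻¹ * ∫ x, F x := by
    rw [Measure.integral_comp_smul_of_nonneg volume F h (hR := hh.le)]
    simp
  rw [this, punctured]
  simp only [gridPt_eq_smul h]
  field_simp

theorem HasCompactSupport.comp_smul_pos {F : Plane → ℝ} (hc : HasCompactSupport F) {h : ℝ}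
    (hh : 0 < h) : HasCompactSupport fun x => F (h • x) :=
  hc.comp_homeomorph (Homeomorph.smulOfNeZero h hh.ne')

theorem exists_quadrature_bound {s : ℝ} {M : ℕ} (hs : -2 < s) (hM : s + 2 < M) :
    ∃ C : ℝ, 0 ≤ C ∧ ∀ (B : ℝ) (F : Plane → ℝ), IsSymbol s M B F → HasCompactSupport F →
      ∀ h : ℝ, 0 < h → |punctured h F - ∫ x, F x| ≤ C * B * h ^ (s + 2) := by
  obtain ⟨C, hC0, hC⟩ := exists_lattice_quadrature_bound hs hM
  refine ⟨C, hC0, fun B F hF hc h hh => ?_⟩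
  rw [punctured_sub_integral hh, abs_mul, abs_of_nonneg (by positivity)]
  calc _ ≤ h ^ 2 * (C * (B * h ^ s)) := by
        gcongr
        exact hC _ _ (hF.comp_smul hh) (HasCompactSupport.comp_smul_pos hc hh)
    _ = _ := by
        rw [Real.rpow_add hh, Real.rpow_ofNat]; ring

/-! ### The kernel, the window `g` and the limit of the scaled error -/

theorem contDiff_coord (i : Fin 2) : ContDiff ℝ ∞ fun x : Plane => x i :=
  (EuclideanSpace.proj (𝕜 := ℝ) i).contDiff

theorem contDiffOn_kernel (α : ℝ) : ContDiffOn ℝ ∞ (kernel α) {0}ᶜ := by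
  intro x hx
  have hx : x ≠ 0 := hx
  have hx0 : ‖x‖ ≠ 0 := norm_ne_zero_iff.2 hx
  refine (((contDiff_coord 0).mul (contDiff_coord 1)).contDiffAt.div
    ((contDiffAt_norm ℝ hx).rpow_const_of_ne hx0) ?_).contDiffWithinAt
  exact (Real.rpow_pos_of_pos (norm_pos_iff.2 hx) _).ne'

theorem kernel_smul (α : ℝ) {c : ℝ} (hc : 0 < c) (x : Plane) :
    kernel α (c • x) = c ^ (-α) * kernel α x := by
  simp only [kernel, PiLp.smul_apply, smul_eq_mul, norm_smul, Real.norm_of_nonneg hc.le]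
  rw [Real.mul_rpow hc.le (norm_nonneg _), Real.rpow_add hc, Real.rpow_neg hc.le, Real.rpow_ofNat]
  have := (Real.rpow_pos_of_pos hc α).ne'
  field_simp

theorem kernel_mul_monomial_smul (α : ℝ) (a b : ℕ) (c : ℝ) (hc : 0 < c) (x : Plane) :
    kernel α (c • x) * ((c • x) 0 ^ a * (c • x) 1 ^ b)
      = c ^ ((a : ℝ) + b - α) * (kernel α x * (x 0 ^ a * x 1 ^ b)) := by
  rw [kernel_smul α hc, sub_eq_add_neg, Real.rpow_add hc, Real.rpow_add hc, Real.rpow_natCast,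
    Real.rpow_natCast]
  simp only [PiLp.smul_apply, smul_eq_mul]
  ring

theorem exists_isSymbol_kernel (α : ℝ) (M : ℕ) : ∃ B, IsSymbol (-α) M B (kernel α) :=
  exists_isSymbol_of_homogeneous (contDiffOn_kernel α) (fun _ hc x => kernel_smul α hc x) M

theorem exists_forall_norm_ge_eq_zero {F : Plane → ℝ} (hF : HasCompactSupport F) :
    ∃ R, ∀ x, R ≤ ‖x‖ → F x = 0 := by
  obtain ⟨r, hr⟩ := hF.isCompact.isBounded.subset_ball (0 : Plane)
  refine ⟨r, fun x hx => ?_⟩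
  by_contra h
  have := hr (subset_tsupport F h)
  rw [mem_ball_zero_iff] at this
  linarith

theorem iteratedFDeriv_sub_one_eq_zero {n : ℕ} {g : Plane → ℝ} (hg : ContDiff ℝ ∞ g)
    (hg0 : g 0 = 1) (hgd : ∀ j : ℕ, 1 ≤ j → j < n → iteratedFDeriv ℝ j g 0 = 0) (j : ℕ)
    (hj : j < n) : iteratedFDeriv ℝ j (fun x => g x - 1) 0 = 0 := by
  have hsub : iteratedFDeriv ℝ j (fun x => g x - 1) 0 =
      iteratedFDeriv ℝ j g 0 - iteratedFDeriv ℝ j (fun _ : Plane => (1 : ℝ)) 0 :=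
    iteratedFDeriv_sub_apply (hg.of_le (by exact_mod_cast le_top)).contDiffAt
      contDiff_const.contDiffAt
  rcases Nat.eq_zero_or_pos j with rfl | hj0
  · ext v
    simp [hg0]
  · rw [hsub, hgd j hj0 hj, iteratedFDeriv_const_of_ne hj0.ne']
    simp

theorem exists_isSymbol_sub_one {n M : ℕ} (hnM : n ≤ M) {g : Plane → ℝ} (hg : ContDiff ℝ ∞ g)
    (hgc : HasCompactSupport g) (hg0 : g 0 = 1)
    (hgd : ∀ j : ℕ, 1 ≤ j → j < n → iteratedFDeriv ℝ j g 0 = 0) :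
    ∃ B, IsSymbol n M B (fun x => g x - 1) := by
  obtain ⟨R, hR⟩ := exists_forall_norm_ge_eq_zero hgc
  exact exists_isSymbol_of_vanish (c := -1) (R := R) hnM
    ((hg.of_le (by exact_mod_cast le_top)).sub contDiff_const)
    (fun x hx => by simp [hR x hx]) (iteratedFDeriv_sub_one_eq_zero hg hg0 hgd)

theorem summable_lattice {F : Plane → ℝ} (hF : HasCompactSupport F) {h : ℝ} (hh : 0 < h) :
    Summable fun β : {β : ℤ × ℤ // β ≠ 0} => F (gridPt h β) := by
  obtain ⟨S, hS⟩ := exists_finset_vanish (HasCompactSupport.comp_smul_pos hF hh) 0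
  have : Summable fun β : ℤ × ℤ => F (gridPt h β) :=
    summable_of_ne_finset_zero (s := S) fun β hβ => by
      have := hS 0 (by simp) β hβ
      rwa [zero_add, ← gridPt_eq_smul] at this
  exact this.subtype _

theorem exists_limit_of_cauchy_bound {S : ℝ → ℝ} {C : ℝ} {n : ℕ} (hn : n ≠ 0)
    (hS : ∀ h h' : ℝ, 0 < h → 0 < h' → |S h - S h'| ≤ C * (h ^ n + h' ^ n)) :
    ∃ c, ∀ h : ℝ, 0 < h → |S h - c| ≤ C * h ^ n := by
  have hC : 0 ≤ C := by
    have := (abs_nonneg _).trans (hS 1 1 one_pos one_pos)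
    norm_num at this
    linarith
  have hlim : Tendsto (fun k : ℕ => (1 / ((k : ℝ) + 1)) ^ n) atTop (𝓝 0) := by
    simpa [hn] using (tendsto_one_div_add_atTop_nhds_zero_nat (𝕜 := ℝ)).pow n
  have hpos : ∀ k : ℕ, 0 < 1 / ((k : ℝ) + 1) := fun k => by positivity
  have hcau : CauchySeq fun k : ℕ => S (1 / ((k : ℝ) + 1)) := by
    refine cauchySeq_of_le_tendsto_0 (fun k => C * (2 * (1 / ((k : ℝ) + 1)) ^ n)) ?_ ?_
    · intro i j N hi hj
      rw [Real.dist_eq]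
      refine (hS _ _ (hpos i) (hpos j)).trans ?_
      rw [two_mul]
      gcongr
    · simpa using (hlim.const_mul 2).const_mul C
  obtain ⟨c, hc⟩ := cauchySeq_tendsto_of_complete hcau
  refine ⟨c, fun h hh => ?_⟩
  -- Let `h'` tend to 0 along `1 / (k + 1)` in the Cauchy estimate.
  refine le_of_tendsto_of_tendsto (hc.const_sub (S h)).abs
    (b := atTop) (g := fun k : ℕ => C * (h ^ n + (1 / ((k : ℝ) + 1)) ^ n)) ?_
    (Eventually.of_forall fun k => hS h _ hh (hpos k))
  simpa using (hlim.const_add (h ^ n)).const_mul C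

/-- By homogeneity the scaled error equals the unit-lattice error `S h` of `g(hx) σ(x)`. The
difference `S h - S h'` is the error of a symbol of order `n + d` with constant `O(h^n + h'^n)`,
because `g - 1` vanishes to order `n`; the growing supports do not enter. -/
theorem exists_scaled_error_limit {d : ℝ} (hd : -2 < d) {σ : Plane → ℝ}
    (hσ : ContDiffOn ℝ ∞ σ {0}ᶜ) (hom : ∀ c : ℝ, 0 < c → ∀ x, σ (c • x) = c ^ d * σ x)
    {g : Plane → ℝ} (hg : ContDiff ℝ ∞ g) (hgc : HasCompactSupport g) (hg0 : g 0 = 1) {n : ℕ}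
    (hn : n ≠ 0) (hgd : ∀ j : ℕ, 1 ≤ j → j < n → iteratedFDeriv ℝ j g 0 = 0) :
    ∃ c C : ℝ, ∀ h : ℝ, 0 < h →
      |h ^ (-(d + 2)) * ((∫ x, g x * σ x) - punctured h fun x => g x * σ x) - c| ≤ C * h ^ n := by
  obtain ⟨M₀, hM₀⟩ := exists_nat_gt ((n : ℝ) + d + 2)
  set M := M₀ + n
  have hM : (n : ℝ) + d + 2 < M := by
    refine hM₀.trans_le ?_
    exact_mod_cast Nat.le_add_right M₀ n
  obtain ⟨A, hA⟩ := exists_isSymbol_of_homogeneous hσ hom M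
  obtain ⟨B, hB⟩ := exists_isSymbol_sub_one (Nat.le_add_left n M₀) hg hgc hg0 hgd
  obtain ⟨C, hC0, hC⟩ := exists_lattice_quadrature_bound (s := n + d) (M := M)
    (by have : (0 : ℝ) ≤ n := n.cast_nonneg
        linarith) hM
  obtain ⟨R, hR⟩ := exists_forall_norm_ge_eq_zero hgc
  obtain ⟨D, hD⟩ := exists_isSymbol_of_vanish (n := 0) (Nat.zero_le M)
    (hg.of_le (by exact_mod_cast le_top)) hR (by simp)
  have hgσ : ∀ h : ℝ, 0 < h → Integrable (fun x => g (h • x) * σ x) ∧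
      HasCompactSupport (fun x => g (h • x) * σ x) := fun h hh => by
    have hc : HasCompactSupport (fun x => g (h • x) * σ x) :=
      (HasCompactSupport.comp_smul_pos hgc hh).mul_right
    exact ⟨((hD.comp_smul hh).mul hA).integrable (by simpa using hd) hc, hc⟩
  let S : ℝ → ℝ := fun h =>
    (∫ x, g (h • x) * σ x) - ∑' β : {β : ℤ × ℤ // β ≠ 0}, g (h • gridPt 1 β) * σ (gridPt 1 β)
  have hS : ∀ h : ℝ, 0 < h →
      h ^ (-(d + 2)) * ((∫ x, g x * σ x) - punctured h fun x => g x * σ x) = S h := by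
    intro h hh
    have := punctured_sub_integral hh (fun x => g x * σ x)
    rw [← neg_sub, this]
    simp only [hom h hh, mul_left_comm _ (h ^ d), tsum_mul_left, integral_const_mul, S]
    rw [Real.rpow_neg hh.le, Real.rpow_add hh, Real.rpow_ofNat]
    have := (Real.rpow_pos_of_pos hh d).ne'
    field_simp
    ring
  obtain ⟨c, hc⟩ := exists_limit_of_cauchy_bound (S := S) (C := C * (2 ^ M * B * A)) hn
    (fun h h' hh hh' => by
      have h1 : IsSymbol (n + d) M (2 ^ M * (B * h ^ (n : ℝ) + B * h' ^ (n : ℝ)) * A)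
          (fun x => (g (h • x) - 1 - (g (h' • x) - 1)) * σ x) :=
        ((hB.comp_smul hh).sub (hB.comp_smul hh')).mul hA
      have h2 : (fun x => (g (h • x) - 1 - (g (h' • x) - 1)) * σ x)
          = fun x => g (h • x) * σ x - g (h' • x) * σ x := by
        ext x; ring
      rw [h2] at h1
      have h3 := hC _ _ h1 ((hgσ h hh).2.sub (hgσ h' hh').2)
      have e1 := Summable.tsum_sub (by simpa using summable_lattice (hgσ h hh).2 one_pos)
        (summable_lattice (hgσ h' hh').2 one_pos)
      rw [e1, integral_sub (hgσ h hh).1 (hgσ h' hh').1] at h3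
      rw [← abs_neg]
      calc _ = _ := by congr 1; simp only [S]; ring
        _ ≤ _ := h3
        _ = _ := by rw [Real.rpow_natCast, Real.rpow_natCast]; ring)
  exact ⟨c, _, fun h hh => by rw [hS h hh]; exact hc h hh⟩

/-! ### Unisolvence and invertibility of `K` -/

open Polynomial in
/-- Unisolvence of the triangular lattice `{(t i, t j) : i + j ≤ n}` for polynomials of total degree
at most `n`, written as `∑ j ≤ n, A j (x) y ^ j`. -/
theorem eq_zero_of_eval_triangle {n : ℕ} {t : ℕ → ℝ} (ht : Function.Injective t) {A : ℕ → ℝ[X]}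
    (hA : ∀ j ≤ n, (A j).natDegree ≤ n - j)
    (h0 : ∀ i j, i + j ≤ n →
      ∑ k ∈ Finset.range (n + 1), (A k).eval (t i) * t j ^ k = 0) :
    ∀ j ≤ n, A j = 0 := by
  have hzero : ∀ m, (∀ k < m, ∀ j ≤ n, (A j).eval (t k) = 0) → ∀ j ≤ n, n - j < m → A j = 0 := by
    intro m hm j hj hjm
    refine eq_zero_of_natDegree_lt_card_of_eval_eq_zero (A j) (ι := Fin m) (f := fun k => t k)
      (fun a b hab => Fin.ext (ht hab)) (fun k => hm k k.2 j hj) ?_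
    simpa using (hA j hj).trans_lt hjm
  -- Sweep the lines `x = t k`. Once `k` lines are done, every `A j` with `n - j < k` has more roots
  -- than its degree allows and is zero; on the next line a polynomial in `y` of degree at most `n -
  -- k` then has `n - k + 1` zeros.
  have key : ∀ m ≤ n + 1, ∀ k < m, ∀ j ≤ n, (A j).eval (t k) = 0 := by
    intro m
    induction m with
    | zero => intro _ k hk; omega
    | succ m ih =>
      intro hm k hk
      have ih := ih (by omega)
      rcases Nat.lt_succ_iff_lt_or_eq.1 hk with hk | rfl
      · exact ih k hk
      let q : ℝ[X] := ∑ j ∈ Finset.range (n + 1), C ((A j).eval (t k)) * X ^ j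
      have hq : q = 0 := by
        refine eq_zero_of_natDegree_lt_card_of_eval_eq_zero q (ι := Fin (n - k + 1))
          (f := fun j => t j) (fun a b hab => Fin.ext (ht hab)) (fun j => ?_) ?_
        · simpa [q, eval_finsetSum] using h0 k j (by omega)
        · rw [Fintype.card_fin, Nat.lt_succ_iff]
          refine natDegree_sum_le_of_forall_le _ _ fun j hj => ?_
          rcases le_or_gt j (n - k) with hjk | hjk
          · exact (natDegree_C_mul_X_pow_le _ _).trans hjk
          · rw [hzero k ih j (by simpa [Nat.lt_succ_iff] using hj)
              (by have := Finset.mem_range.1 hj; omega)]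
            simp
      intro j hj
      have hcoef := congrArg (fun p => p.coeff j) hq
      simpa [q, finsetSum_coeff, coeff_C_mul, coeff_X_pow, Nat.lt_succ_iff.2 hj, hj] using hcoef
  intro j hj
  exact hzero (n + 1) (key (n + 1) le_rfl) j hj (by omega)

theorem mem_idx {p : ℕ} {ξ : ℕ × ℕ} : ξ ∈ idx p ↔ 1 ≤ ξ.2 ∧ ξ.2 ≤ ξ.1 ∧ ξ.1 + ξ.2 ≤ p := by
  simp only [idx, Finset.mem_biUnion, Finset.mem_Icc, Finset.mem_image]
  constructor
  · rintro ⟨q, hq, m, hm, rfl⟩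
    dsimp only
    omega
  · rintro ⟨h1, h2, h3⟩
    exact ⟨ξ.1 + ξ.2, by omega, ξ.2, by omega, Prod.ext (by simp) rfl⟩

theorem mem_orbit {γ : ℕ × ℕ} {β : ℤ × ℤ} : β ∈ orbit γ ↔
    (β.1.natAbs = γ.1 ∧ β.2.natAbs = γ.2) ∨ (β.1.natAbs = γ.2 ∧ β.2.natAbs = γ.1) := by
  obtain ⟨a, b⟩ := γ
  obtain ⟨c, d⟩ := β
  simp only [orbit, Finset.mem_insert, Finset.mem_singleton, Prod.mk.injEq]
  omega

/-- The sign compensates the odd powers, so the summands of `K` depend only on absolute values and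
an orbit sum collapses to two terms. -/
theorem sgn_mul_odd_monomial (β : ℤ × ℤ) (m n : ℕ) :
    sgn β * ((β.1 : ℝ) ^ (2 * m + 1) * (β.2 : ℝ) ^ (2 * n + 1)) =
      (β.1.natAbs : ℝ) ^ (2 * m + 1) * (β.2.natAbs : ℝ) ^ (2 * n + 1) := by
  have key : ∀ (z : ℤ) (m : ℕ), ((z.sign : ℤ) : ℝ) * (z : ℝ) ^ (2 * m + 1)
      = (z.natAbs : ℝ) ^ (2 * m + 1) := by
    intro z m
    rw [pow_succ, pow_succ, mul_left_comm, pow_mul, pow_mul, Nat.cast_natAbs, Int.cast_abs, sq_abs]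
    congr 1
    rw [← Int.cast_abs, ← Int.sign_mul_self_eq_abs]
    push_cast
    ring
  rw [← key, ← key, sgn, Int.sign_mul]
  push_cast
  ring

theorem orbit_sum (γ : ℕ × ℕ) (h1 : 1 ≤ γ.1) (h2 : 1 ≤ γ.2) :
    ∃ κ : ℝ, κ ≠ 0 ∧ ∀ f : ℕ → ℕ → ℝ,
      ∑ β ∈ orbit γ, f β.1.natAbs β.2.natAbs = κ * (f γ.1 γ.2 + f γ.2 γ.1) := by
  obtain ⟨a, b⟩ := γ
  dsimp only at h1 h2
  by_cases hab : a = b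
  · subst hab
    -- On the diagonal all summands coincide, while the right-hand side counts `f a a` twice.
    refine ⟨(orbit (a, a)).card / 2, ?_, fun f => ?_⟩
    · have : (orbit (a, a)).card ≠ 0 :=
        Finset.card_ne_zero_of_mem (a := ((a : ℤ), (a : ℤ))) (mem_orbit.2 (by simp))
      positivity
    · rw [Finset.sum_congr rfl (g := fun _ => f a a), Finset.sum_const, nsmul_eq_mul]
      · ring
      · intro β hβ
        rcases mem_orbit.1 hβ with h | h <;> rw [h.1, h.2]
  · refine ⟨4, by norm_num, fun f => ?_⟩
    simp only [orbit]
    rw [Finset.sum_insert, Finset.sum_insert, Finset.sum_insert, Finset.sum_insert,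
      Finset.sum_insert, Finset.sum_insert, Finset.sum_insert, Finset.sum_singleton]
    · simp only [Int.natAbs_neg, Int.natAbs_natCast]
      ring
    all_goals
      simp only [Finset.mem_insert, Finset.mem_singleton, Prod.mk.injEq]
      omega

theorem exists_coeffK_eq {p : ℕ} (γ : idx p) : ∃ κ : ℝ, κ ≠ 0 ∧ ∀ ξ : idx p, coeffK p ξ γ =
    κ * ((γ.1.1 : ℝ) ^ (2 * ξ.1.1 - 1) * (γ.1.2 : ℝ) ^ (2 * ξ.1.2 - 1) +
      (γ.1.2 : ℝ) ^ (2 * ξ.1.1 - 1) * (γ.1.1 : ℝ) ^ (2 * ξ.1.2 - 1)) := by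
  have hγ := mem_idx.1 γ.2
  obtain ⟨κ, hκ, h⟩ := orbit_sum γ.1 (by omega) (by omega)
  refine ⟨κ, hκ, fun ξ => ?_⟩
  have hξ := mem_idx.1 ξ.2
  rw [← h fun m n => (m : ℝ) ^ (2 * ξ.1.1 - 1) * (n : ℝ) ^ (2 * ξ.1.2 - 1)]
  refine Finset.sum_congr rfl fun β _ => ?_
  rw [show 2 * ξ.1.1 - 1 = 2 * (ξ.1.1 - 1) + 1 by omega,
    show 2 * ξ.1.2 - 1 = 2 * (ξ.1.2 - 1) + 1 by omega, sgn_mul_odd_monomial]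

/-- After a nonzero factor is removed from each column, a left null vector becomes a symmetric
polynomial of degree at most `p - 2` in `(x², y²)`. It vanishes at the points of `I_p`, by symmetry
at their swaps too, hence on a full triangular lattice. -/
theorem eq_zero_of_vecMul_coeffK {p : ℕ} {v : idx p → ℝ} (hv : v ᵥ* coeffK p = 0) : v = 0 := by
  classical
  let w : ℕ × ℕ → ℝ := fun ξ => if h : ξ ∈ idx p then v ⟨ξ, h⟩ else 0
  have hw : ∀ ξ : idx p, w ξ.1 = v ξ := fun ξ => by simp [w]
  have hw0 : ∀ ξ, ξ ∉ idx p → w ξ = 0 := fun ξ h => by simp [w, h]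
  obtain hp | ⟨n, rfl⟩ : p < 2 ∨ ∃ n, p = n + 2 := by
    rcases lt_or_ge p 2 with h | h
    · exact Or.inl h
    · exact Or.inr ⟨p - 2, by omega⟩
  · ext ξ
    have := mem_idx.1 ξ.2
    omega
  let V : ℕ → ℕ → ℝ := fun l k => w (l + 1, k + 1)
  let F : ℝ → ℝ → ℕ → ℕ → ℝ := fun x y l k => x ^ l * y ^ k + y ^ l * x ^ k
  have hsum : ∀ x y, ∑ ξ : idx (n + 2), v ξ * F x y (ξ.1.1 - 1) (ξ.1.2 - 1) =
      ∑ l ∈ Finset.range (n + 1), ∑ k ∈ Finset.range (n + 1), V l k * F x y l k := by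
    intro x y
    rw [← Finset.sum_product']
    have hw' : ∀ ξ : idx (n + 2), v ξ * F x y (ξ.1.1 - 1) (ξ.1.2 - 1) =
        w ξ.1 * F x y (ξ.1.1 - 1) (ξ.1.2 - 1) := fun ξ => by rw [hw]
    rw [Fintype.sum_congr _ _ hw', Finset.sum_coe_sort (idx (n + 2))
      (fun ξ => w ξ * F x y (ξ.1 - 1) (ξ.2 - 1))]
    refine Finset.sum_of_injOn (fun ξ => (ξ.1 - 1, ξ.2 - 1)) ?_ ?_ ?_ ?_
    · intro ξ hξ ζ hζ h
      have h1 := mem_idx.1 hξ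
      have h2 := mem_idx.1 hζ
      simp only [Prod.mk.injEq] at h
      exact Prod.ext (by omega) (by omega)
    · intro ξ hξ
      have h1 := mem_idx.1 hξ
      simp only [Finset.coe_product, Finset.coe_range, Set.mem_prod, Set.mem_Iio]
      omega
    · intro z _ hz
      have : (z.1 + 1, z.2 + 1) ∉ idx (n + 2) := fun h => hz ⟨_, h, by simp⟩
      simp [V, hw0 _ this]
    · intro ξ hξ
      have h1 := mem_idx.1 hξ
      simp only [V]
      rw [Nat.sub_add_cancel (by omega), Nat.sub_add_cancel (by omega)]
  have hvan : ∀ i j, j ≤ i → i + j ≤ n →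
      ∑ l ∈ Finset.range (n + 1), ∑ k ∈ Finset.range (n + 1),
        V l k * F (((i : ℝ) + 1) ^ 2) (((j : ℝ) + 1) ^ 2) l k = 0 := by
    intro i j hji hij
    rw [← hsum]
    have hmem : (i + 1, j + 1) ∈ idx (n + 2) := mem_idx.2 ⟨by omega, by simpa using hji, by omega⟩
    obtain ⟨κ, hκ, hK⟩ := exists_coeffK_eq ⟨_, hmem⟩
    have h := congrFun hv ⟨_, hmem⟩
    simp only [Matrix.vecMul, dotProduct, hK, Pi.zero_apply] at h
    have hodd : ∀ (x : ℝ) (m : ℕ), 1 ≤ m → x ^ (2 * m - 1) = x * (x ^ 2) ^ (m - 1) := by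
      intro x m hm
      rw [← pow_mul, ← pow_succ']
      congr 1
      omega
    have hfac : (κ * ((i : ℝ) + 1) * ((j : ℝ) + 1)) * ∑ ξ : idx (n + 2), v ξ *
        F (((i : ℝ) + 1) ^ 2) (((j : ℝ) + 1) ^ 2) (ξ.1.1 - 1) (ξ.1.2 - 1) = 0 := by
      rw [← h, Finset.mul_sum]
      refine Finset.sum_congr rfl fun ξ _ => ?_
      have hξ := mem_idx.1 ξ.2
      push_cast
      rw [hodd _ _ (by omega), hodd _ _ hξ.1, hodd _ _ (by omega), hodd _ _ hξ.1]
      simp only [F]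
      ring
    refine (mul_eq_zero.1 hfac).resolve_left ?_
    have : (i : ℝ) + 1 ≠ 0 := by positivity
    have : (j : ℝ) + 1 ≠ 0 := by positivity
    positivity
  have hFsymm : ∀ x y l k, F x y l k = F y x l k := fun x y l k => add_comm _ _
  have hvan' : ∀ i j, i + j ≤ n →
      ∑ l ∈ Finset.range (n + 1), ∑ k ∈ Finset.range (n + 1),
        V l k * F (((i : ℝ) + 1) ^ 2) (((j : ℝ) + 1) ^ 2) l k = 0 := by
    intro i j hij
    rcases le_total j i with h | h
    · exact hvan i j h hij
    · simp only [hFsymm (((i : ℝ) + 1) ^ 2)]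
      exact hvan j i h (by omega)
  have hV0 : ∀ l k, n < l + k → V l k = 0 := fun l k h => hw0 _ fun hm => by
    have := mem_idx.1 hm
    dsimp only at this
    omega
  -- The coefficients are symmetrised. As `V` lives on `k ≤ l`, an off-diagonal entry of `v` is
  -- recovered as it is, and a diagonal one doubled.
  let A : ℕ → Polynomial ℝ := fun k =>
    ∑ l ∈ Finset.range (n + 1), Polynomial.monomial l (V l k + V k l)
  have hA0 := eq_zero_of_eval_triangle (n := n) (t := fun i => ((i : ℝ) + 1) ^ 2) (A := A)
    (fun a b hab => by
      have := (sq_eq_sq₀ (by positivity) (by positivity)).1 hab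
      exact_mod_cast add_right_cancel this)
    (fun k _ => Polynomial.natDegree_sum_le_of_forall_le _ _ fun l _ => by
      rcases le_or_gt l (n - k) with h | h
      · exact (Polynomial.natDegree_monomial_le _).trans h
      · rw [hV0 l k (by omega), hV0 k l (by omega)]
        simp)
    (fun i j hij => by
      rw [← hvan' i j hij]
      simp only [A, Polynomial.eval_finsetSum, Polynomial.eval_monomial, Finset.sum_mul, F, mul_add,
        add_mul, Finset.sum_add_distrib]
      congr 1
      · rw [Finset.sum_comm]
        simp only [mul_assoc]
      · refine Finset.sum_congr rfl fun l _ => Finset.sum_congr rfl fun k _ => ?_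
        ring)
  ext ξ
  have hξ := mem_idx.1 ξ.2
  have hc := congrArg (fun q => q.coeff (ξ.1.1 - 1)) (hA0 (ξ.1.2 - 1) (by omega))
  have hlt : ξ.1.1 - 1 < n + 1 := by omega
  simp only [A, Polynomial.finsetSum_coeff, Polynomial.coeff_monomial, Finset.sum_ite_eq',
    Finset.mem_range, hlt, if_true, Polynomial.coeff_zero, V] at hc
  rw [Nat.sub_add_cancel (by omega), Nat.sub_add_cancel (by omega)] at hc
  rw [Prod.mk.eta, hw] at hc
  rcases eq_or_lt_of_le hξ.2.1 with he | hlt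
  · have : w (ξ.1.2, ξ.1.1) = v ξ := by
      rw [← hw]
      exact congrArg w (Prod.ext he he.symm)
    rw [this] at hc
    simpa using (by linarith : v ξ = 0)
  · rw [hw0 (ξ.1.2, ξ.1.1) fun h => by
      have := (mem_idx.1 h).2.1
      dsimp only at this
      omega, add_zero] at hc
    exact hc

theorem coeffK_det_ne_zero (p : ℕ) : (coeffK p).det ≠ 0 := fun h => by
  obtain ⟨v, hv, hv0⟩ := Matrix.exists_vecMul_eq_zero_iff.2 h
  exact hv (eq_zero_of_vecMul_coeffK hv0)

/-! ### Symmetry of higher derivatives and Taylor polynomials -/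

section

variable {E F : Type*} [NormedAddCommGroup E] [NormedSpace ℝ E] [NormedAddCommGroup F]
  [NormedSpace ℝ F]

theorem iteratedFDeriv_succ_apply_eq_fderiv {n : ℕ} {f : E → F} (hf : ContDiff ℝ (n + 1 : ℕ) f)
    (x : E) (v : Fin (n + 1) → E) :
    iteratedFDeriv ℝ (n + 1) f x v =
      fderiv ℝ (fun y => iteratedFDeriv ℝ n f y (Fin.tail v)) x (v 0) := by
  have hd : DifferentiableAt ℝ (iteratedFDeriv ℝ n f) x :=
    hf.differentiable_iteratedFDeriv (by exact_mod_cast n.lt_succ_self) x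
  rw [iteratedFDeriv_succ_apply_left, fderiv_continuousMultilinear_apply_const_apply hd]

/-- Swapping the first two arguments is the symmetry of a second derivative; any other adjacent swap
follows by differentiating the induction hypothesis. Adjacent swaps generate all permutations. -/
theorem iteratedFDeriv_comp_swap_adjacent (n : ℕ) :
    ∀ (i : Fin n) {f : E → F} (_ : ContDiff ℝ (n + 1 : ℕ) f) (x : E) (v : Fin (n + 1) → E),
      iteratedFDeriv ℝ (n + 1) f x (v ∘ Equiv.swap i.castSucc i.succ) =
        iteratedFDeriv ℝ (n + 1) f x v := by
  induction n with
  | zero => exact fun i => i.elim0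
  | succ n ih =>
    intro i f hf x v
    have hf' : ContDiff ℝ (n + 1 : ℕ) f := hf.of_le (by exact_mod_cast (n + 1).le_succ)
    refine Fin.cases ?_ (fun j => ?_) i
    · have hG : ContDiff ℝ 2 fun y => iteratedFDeriv ℝ n f y (Fin.tail (Fin.tail v)) :=
        (ContinuousMultilinearMap.apply ℝ (fun _ : Fin n => E) F
          (Fin.tail (Fin.tail v))).contDiff.comp (hf.iteratedFDeriv_right (by norm_cast; omega))
      have key : ∀ w : Fin (n + 2) → E, Fin.tail (Fin.tail w) = Fin.tail (Fin.tail v) →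
          iteratedFDeriv ℝ (n + 2) f x w = fderiv ℝ (fderiv ℝ
            fun y => iteratedFDeriv ℝ n f y (Fin.tail (Fin.tail v))) x (w 0) (w 1) := by
        intro w hw
        rw [iteratedFDeriv_succ_apply_eq_fderiv hf]
        simp only [iteratedFDeriv_succ_apply_eq_fderiv hf', hw]
        have hd : DifferentiableAt ℝ (fderiv ℝ
            fun y => iteratedFDeriv ℝ n f y (Fin.tail (Fin.tail v))) x :=
          (hG.fderiv_right (m := 1) (by norm_num)).differentiable one_ne_zero x
        rw [fderiv_clm_apply hd (differentiableAt_const _)]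
        simp [Fin.tail]
      have hsymm : IsSymmSndFDerivAt ℝ
          (fun y => iteratedFDeriv ℝ n f y (Fin.tail (Fin.tail v))) x :=
        hG.contDiffAt.isSymmSndFDerivAt (by simp)
      rw [key v rfl, key, hsymm.eq]
      · simp
      · ext k
        simp only [Fin.tail, Function.comp_apply]
        rw [Equiv.swap_apply_of_ne_of_ne] <;> simp [Fin.ext_iff]
    · rw [iteratedFDeriv_succ_apply_eq_fderiv hf, iteratedFDeriv_succ_apply_eq_fderiv hf]
      have h0 : (v ∘ Equiv.swap j.succ.castSucc j.succ.succ) 0 = v 0 := by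
        simp only [Function.comp_apply]
        rw [Equiv.swap_apply_of_ne_of_ne] <;> simp [Fin.ext_iff]
      have ht : Fin.tail (v ∘ Equiv.swap j.succ.castSucc j.succ.succ) =
          Fin.tail v ∘ Equiv.swap j.castSucc j.succ := by
        ext k
        simp only [Fin.tail, Function.comp_apply]
        congr 1
        rw [← Fin.succ_castSucc]
        exact ((Fin.succ_injective _).map_swap _ _ _).symm
      rw [h0, ht]
      simp only [ih j hf']

theorem iteratedFDeriv_comp_perm_of_contDiff {n : ℕ} {f : E → F} (hf : ContDiff ℝ n f) (x : E)
    (σ : Equiv.Perm (Fin n)) (v : Fin n → E) :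
    iteratedFDeriv ℝ n f x (v ∘ σ) = iteratedFDeriv ℝ n f x v := by
  cases n with
  | zero => exact congrArg _ (Subsingleton.elim _ _)
  | succ n =>
    have hσ : σ ∈ Submonoid.closure
        (Set.range fun i : Fin n => Equiv.swap i.castSucc i.succ) := by
      rw [Equiv.Perm.mclosure_swap_castSucc_succ]; trivial
    induction hσ using Submonoid.closure_induction generalizing v with
    | mem τ hτ =>
      obtain ⟨i, rfl⟩ := hτ
      exact iteratedFDeriv_comp_swap_adjacent n i hf x v
    | one => rfl
    | mul τ τ' _ _ h h' =>
      rw [Equiv.Perm.coe_mul, ← Function.comp_assoc, h', h]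

end

/-- The polynomial functions on the plane of total degree less than `n`. -/
def polySpan (n : ℕ) : Submodule ℝ (Plane → ℝ) :=
  Submodule.span ℝ {m | ∃ a b : ℕ, a + b < n ∧ m = fun x => x 0 ^ a * x 1 ^ b}

theorem contDiff_of_mem_polySpan {n : ℕ} {P : Plane → ℝ} (hP : P ∈ polySpan n) :
    ContDiff ℝ ∞ P := by
  induction hP using Submodule.span_induction with
  | mem m hm =>
    obtain ⟨a, b, -, rfl⟩ := hm
    exact ((contDiff_coord 0).pow a).mul ((contDiff_coord 1).pow b)
  | zero => exact contDiff_const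
  | add P Q _ _ hP hQ => exact hP.add hQ
  | smul c P _ hP => exact contDiff_const.smul hP

theorem exists_prod_coord_eq (j : ℕ) (r : Fin j → Fin 2) :
    ∃ a b : ℕ, a + b = j ∧ ∀ x : Plane, ∏ k, x (r k) = x 0 ^ a * x 1 ^ b := by
  induction j with
  | zero => exact ⟨0, 0, rfl, by simp⟩
  | succ j ih =>
    obtain ⟨a, b, hab, h⟩ := ih (Fin.tail r)
    simp only [Fin.tail] at h
    rcases Fin.exists_fin_two.1 ⟨r 0, rfl⟩ with h0 | h0
    · refine ⟨a + 1, b, by omega, fun x => ?_⟩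
      rw [Fin.prod_univ_succ, h, ← h0]; ring
    · refine ⟨a, b + 1, by omega, fun x => ?_⟩
      rw [Fin.prod_univ_succ, h, ← h0]; ring

theorem diagonal_mem_polySpan {j n : ℕ} (hj : j < n)
    (A : ContinuousMultilinearMap ℝ (fun _ : Fin j => Plane) ℝ) :
    (fun x => A fun _ => x) ∈ polySpan n := by
  have hA : (fun x => A fun _ => x) = ∑ r : Fin j → Fin 2,
      (A fun k => EuclideanSpace.single (r k) 1) • fun x : Plane => ∏ k, x (r k) := by
    ext x
    have hx : (fun _ : Fin j => x) =
        fun _ => ∑ i : Fin 2, x i • EuclideanSpace.single i (1 : ℝ) := by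
      funext _
      ext i
      fin_cases i <;> simp
    rw [hx, A.map_sum, Finset.sum_apply]
    refine Finset.sum_congr rfl fun r _ => ?_
    rw [A.map_smul_univ]
    simp [mul_comm]
  rw [hA]
  refine Submodule.sum_mem _ fun r _ => Submodule.smul_mem _ _ (Submodule.subset_span ?_)
  obtain ⟨a, b, hab, h⟩ := exists_prod_coord_eq j r
  exact ⟨a, b, by omega, funext h⟩

theorem exists_taylor_polynomial {n : ℕ} {φ : Plane → ℝ} (hφ : ContDiff ℝ n φ) :
    ∃ P ∈ polySpan n, ∀ j < n, iteratedFDeriv ℝ j P 0 = iteratedFDeriv ℝ j φ 0 := by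
  let q : FormalMultilinearSeries ℝ Plane ℝ := fun j =>
    if j < n then (j.factorial : ℝ)⁻¹ • iteratedFDeriv ℝ j φ 0 else 0
  let P : Plane → ℝ := ∑ j ∈ Finset.range n, fun x => q j fun _ => x
  have hP : HasFiniteFPowerSeriesOnBall P q 0 n ⊤ :=
    .mk' (fun m hm => by simp [q, Nat.not_lt.2 hm]) (by simp) fun y _ => by
      simp [P, Finset.sum_apply]
  refine ⟨P, Submodule.sum_mem _ fun j hj =>
    diagonal_mem_polySpan (Finset.mem_range.1 hj) (q j), fun j hj => ?_⟩
  ext v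
  -- The derivative of a power series sums its coefficient over all permutations of the arguments.
  -- The coefficient is already symmetric, so `j!` equal terms cancel the `1 / j!`.
  rw [hP.toHasFPowerSeriesOnBall.iteratedFDeriv_eq_sum_of_completeSpace]
  have hperm : ∀ σ : Equiv.Perm (Fin j), q j (fun i => v (σ i)) =
      (j.factorial : ℝ)⁻¹ * iteratedFDeriv ℝ j φ 0 v := fun σ => by
    simp only [q, if_pos hj, _root_.smul_apply, smul_eq_mul]
    congr 1
    exact iteratedFDeriv_comp_perm_of_contDiff (hφ.of_le (by exact_mod_cast hj.le)) 0 σ v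
  simp only [hperm, Finset.sum_const, Finset.card_univ, Fintype.card_perm, Fintype.card_fin,
    nsmul_eq_mul]
  have : (j.factorial : ℝ) ≠ 0 := by positivity
  field_simp

/-- Division with remainder: a function is a polynomial times `g`, up to a function that vanishes to
order `n` at the origin. -/
theorem exists_remainder_isSymbol {n M : ℕ} (hnM : n ≤ M) {g φ : Plane → ℝ} (hg : ContDiff ℝ ∞ g)
    (hgc : HasCompactSupport g) (hg0 : g 0 = 1)
    (hgd : ∀ j : ℕ, 1 ≤ j → j < n → iteratedFDeriv ℝ j g 0 = 0) (hφ : ContDiff ℝ M φ)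
    (hφc : HasCompactSupport φ) :
    ∃ P ∈ polySpan n, ∃ B, IsSymbol n M B (fun x => φ x - g x * P x) := by
  have hφn : ContDiff ℝ n φ := hφ.of_le (by exact_mod_cast hnM)
  obtain ⟨P, hP, hPφ⟩ := exists_taylor_polynomial hφn
  have hPM : ContDiff ℝ M P := (contDiff_of_mem_polySpan hP).of_le (by exact_mod_cast le_top)
  have hgM : ContDiff ℝ M g := hg.of_le (by exact_mod_cast le_top)
  have hcs : HasCompactSupport fun x => φ x - g x * P x := hφc.sub hgc.mul_right
  obtain ⟨R, hR⟩ := exists_forall_norm_ge_eq_zero hcs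
  refine ⟨P, hP, exists_isSymbol_of_vanish hnM (hφ.sub (hgM.mul hPM)) hR fun j hj => ?_⟩
  have hjM : (j : ℕ∞ω) ≤ M := by exact_mod_cast (hj.le.trans hnM)
  have hg1 : ContDiff ℝ M fun x => g x - 1 := hgM.sub contDiff_const
  -- Both parts vanish to order `n`: the first by the choice of `P`, the second because `g - 1`
  -- does.
  have e : (fun x => φ x - g x * P x) = (φ - P) - fun x => (g x - 1) * P x := by
    ext x
    simp only [Pi.sub_apply]
    ring
  have h1 : iteratedFDeriv ℝ j (fun x => (g x - 1) * P x) 0 = 0 := by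
    rw [← norm_le_zero_iff]
    refine (norm_iteratedFDeriv_mul_le hg1 hPM 0 hjM).trans (le_of_eq ?_)
    refine Finset.sum_eq_zero fun i hi => ?_
    have hij : i ≤ j := Nat.lt_succ_iff.1 (Finset.mem_range.1 hi)
    have : iteratedFDeriv ℝ i (fun x => g x - 1) 0 = 0 :=
      iteratedFDeriv_sub_one_eq_zero hg hg0 hgd i (by omega)
    rw [this]
    simp
  have h2 : ContDiffAt ℝ j (φ - P) 0 := ((hφ.sub hPM).of_le hjM).contDiffAt
  rw [e, iteratedFDeriv_sub_apply h2 ((hg1.mul hPM).of_le hjM).contDiffAt, h1, sub_zero,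
    iteratedFDeriv_sub_apply (hφ.of_le hjM).contDiffAt (hPM.of_le hjM).contDiffAt, hPφ j hj,
    sub_self]

/-! ### Linearity and symmetries of the error functional -/

/-- The error of the corrected trapezoidal rule with weights `w` for the function `φ s₁₂`. -/
noncomputable def ruleError (p : ℕ) (α : ℝ) (w : EuclideanSpace ℝ (idx p)) (φ : Plane → ℝ)
    (h : ℝ) : ℝ :=
  corrected p α w φ h - ∫ x, φ x * kernel α x

/-- The correction term of the corrected rule, without its power of `h`. -/
noncomputable def correction (p : ℕ) (w : EuclideanSpace ℝ (idx p)) (φ : Plane → ℝ) (h : ℝ) : ℝ :=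
  ∑ γ : idx p, w γ * ∑ β ∈ orbit γ.1, sgn β * φ (gridPt h β)

theorem ruleError_eq (p : ℕ) (α : ℝ) (w : EuclideanSpace ℝ (idx p)) (φ : Plane → ℝ) (h : ℝ) :
    ruleError p α w φ h =
      (punctured h (fun x => φ x * kernel α x) - ∫ x, φ x * kernel α x) +
        h ^ (2 - α) * correction p w φ h := by
  rw [ruleError, corrected, correction]; ring

theorem integrable_mul_kernel {α : ℝ} (hα : α < 2) {φ : Plane → ℝ} (hφ : Continuous φ)
    (hc : HasCompactSupport φ) : Integrable (fun x => φ x * kernel α x) := by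
  obtain ⟨R, hR⟩ := exists_forall_norm_ge_eq_zero hc
  obtain ⟨A, hA⟩ := exists_isSymbol_of_vanish (n := 0) le_rfl (contDiff_zero.2 hφ) hR (by simp)
  obtain ⟨B, hB⟩ := exists_isSymbol_kernel α 0
  exact (hA.mul hB).integrable (by push_cast; linarith) hc.mul_right

section Linearity

variable {p : ℕ} {α : ℝ} {w : EuclideanSpace ℝ (idx p)} {φ ψ : Plane → ℝ} {h : ℝ}

theorem ruleError_add (hα : α < 2) (hφ : Continuous φ) (hφc : HasCompactSupport φ)
    (hψ : Continuous ψ) (hψc : HasCompactSupport ψ) (hh : 0 < h) :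
    ruleError p α w (φ + ψ) h = ruleError p α w φ h + ruleError p α w ψ h := by
  have h1 : ∫ x, (φ + ψ) x * kernel α x =
      (∫ x, φ x * kernel α x) + ∫ x, ψ x * kernel α x := by
    rw [← integral_add (integrable_mul_kernel hα hφ hφc) (integrable_mul_kernel hα hψ hψc)]
    simp only [Pi.add_apply, add_mul]
  have h2 : punctured h (fun x => (φ + ψ) x * kernel α x) =
      punctured h (fun x => φ x * kernel α x) + punctured h (fun x => ψ x * kernel α x) := by
    simp only [punctured, Pi.add_apply, add_mul]
    rw [Summable.tsum_add (summable_lattice (F := fun x => φ x * kernel α x) hφc.mul_right hh)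
      (summable_lattice (F := fun x => ψ x * kernel α x) hψc.mul_right hh), mul_add]
  have h3 : correction p w (φ + ψ) h = correction p w φ h + correction p w ψ h := by
    simp only [correction, Pi.add_apply, mul_add, Finset.sum_add_distrib]
  rw [ruleError_eq, ruleError_eq, ruleError_eq, h1, h2, h3]
  ring

theorem ruleError_smul (c : ℝ) : ruleError p α w (c • φ) h = c * ruleError p α w φ h := by
  have h3 : correction p w (c • φ) h = c * correction p w φ h := by
    simp only [correction, Pi.smul_apply, smul_eq_mul, mul_left_comm _ c, Finset.mul_sum]
  have h2 : punctured h (fun x => (c • φ) x * kernel α x) =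
      c * punctured h (fun x => φ x * kernel α x) := by
    simp only [punctured, Pi.smul_apply, smul_eq_mul, mul_assoc, tsum_mul_left]
    ring
  have h1 : ∫ x, (c • φ) x * kernel α x = c * ∫ x, φ x * kernel α x := by
    simp only [Pi.smul_apply, smul_eq_mul, mul_assoc, integral_const_mul]
  rw [ruleError_eq, ruleError_eq, h1, h2, h3]
  ring

end Linearity

/-- A symmetry of the plane that acts on the grid and on the singular kernel acts on the rule. -/
theorem ruleError_comp_isometry {p : ℕ} {α : ℝ} {w : EuclideanSpace ℝ (idx p)} {h ε : ℝ}
    (e : Plane ≃ₗᵢ[ℝ] Plane) (τ : ℤ × ℤ ≃ ℤ × ℤ) (hε : ε * ε = 1) (hτ0 : ∀ β, τ β ≠ 0 ↔ β ≠ 0)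
    (heτ : ∀ β, e (gridPt h β) = gridPt h (τ β)) (hk : ∀ x, kernel α (e x) = ε * kernel α x)
    (hs : ∀ β, sgn (τ β) = ε * sgn β) (ho : ∀ γ β, τ β ∈ orbit γ ↔ β ∈ orbit γ)
    (φ : Plane → ℝ) : ruleError p α w (φ ∘ e) h = ε * ruleError p α w φ h := by
  have hk' : ∀ x, φ (e x) * kernel α x = ε * (φ (e x) * kernel α (e x)) := fun x => by
    rw [hk, mul_left_comm ε, ← mul_assoc ε ε, hε, one_mul]
  have h1 : ∫ x, (φ ∘ e) x * kernel α x = ε * ∫ x, φ x * kernel α x := by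
    simp only [Function.comp_apply, hk', integral_const_mul]
    congr 1
    exact e.measurePreserving.integral_comp e.toHomeomorph.measurableEmbedding
      fun x => φ x * kernel α x
  have h2 : punctured h (fun x => (φ ∘ e) x * kernel α x) =
      ε * punctured h (fun x => φ x * kernel α x) := by
    simp only [punctured, Function.comp_apply, hk', tsum_mul_left]
    rw [mul_left_comm]
    congr 2
    rw [← Equiv.tsum_eq (τ.subtypeEquiv fun β => (hτ0 β).symm)
      fun β : {β : ℤ × ℤ // β ≠ 0} => φ (gridPt h β) * kernel α (gridPt h β)]
    refine tsum_congr fun β => ?_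
    simp [heτ]
  have h3 : correction p w (φ ∘ e) h = ε * correction p w φ h := by
    simp only [correction, Function.comp_apply, Finset.mul_sum]
    refine Finset.sum_congr rfl fun γ _ => ?_
    refine Finset.sum_equiv τ (fun β => (ho γ.1 β).symm) fun β _ => ?_
    rw [hs, heτ, mul_left_comm ε, mul_assoc ε, ← mul_assoc ε ε, hε, one_mul]
  rw [ruleError_eq, ruleError_eq, h1, h2, h3]
  ring

/-- The reflection `(x₁, x₂) ↦ (-x₁, x₂)`. -/
noncomputable def reflectFst : Plane ≃ₗᵢ[ℝ] Plane :=
  LinearIsometryEquiv.piLpCongrRight 2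
    ![LinearIsometryEquiv.neg ℝ, LinearIsometryEquiv.refl ℝ ℝ]

@[simp] theorem reflectFst_zero (x : Plane) : reflectFst x 0 = -x 0 := by
  simp [reflectFst]

@[simp] theorem reflectFst_one (x : Plane) : reflectFst x 1 = x 1 := by
  simp [reflectFst]

/-- The reflection `(x₁, x₂) ↦ (x₂, x₁)`. -/
noncomputable def swapCoords : Plane ≃ₗᵢ[ℝ] Plane :=
  LinearIsometryEquiv.piLpCongrLeft 2 ℝ ℝ (Equiv.swap 0 1)

@[simp] theorem swapCoords_zero (x : Plane) : swapCoords x 0 = x 1 := by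
  simp [swapCoords]

@[simp] theorem swapCoords_one (x : Plane) : swapCoords x 1 = x 0 := by
  simp [swapCoords]

section Symmetry

variable {p : ℕ} {α : ℝ} {w : EuclideanSpace ℝ (idx p)} {h : ℝ}

theorem ruleError_comp_reflectFst (φ : Plane → ℝ) :
    ruleError p α w (φ ∘ reflectFst) h = -ruleError p α w φ h := by
  rw [← neg_one_mul]
  refine ruleError_comp_isometry reflectFst ((Equiv.neg ℤ).prodCongr (Equiv.refl ℤ)) (by norm_num)
    (fun β => ?_) (fun β => ?_) (fun x => ?_) (fun β => ?_) (fun γ β => ?_) φ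
  · simp [Prod.ext_iff]
  · ext i
    fin_cases i
    · simp [gridPt]
    · simp [gridPt]
  · simp only [kernel, reflectFst_zero, reflectFst_one, LinearIsometryEquiv.norm_map]
    ring
  · simp [sgn, Int.sign_neg]
  · simp [mem_orbit]

theorem ruleError_comp_swapCoords (φ : Plane → ℝ) :
    ruleError p α w (φ ∘ swapCoords) h = ruleError p α w φ h := by
  rw [← one_mul (ruleError p α w φ h)]
  refine ruleError_comp_isometry swapCoords (Equiv.prodComm ℤ ℤ) (by norm_num)
    (fun β => ?_) (fun β => ?_) (fun x => ?_) (fun β => ?_) (fun γ β => ?_) φ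
  · simp [Prod.ext_iff, and_comm]
  · ext i
    fin_cases i
    · simp [gridPt]
    · simp [gridPt]
  · simp only [kernel, swapCoords_zero, swapCoords_one, LinearIsometryEquiv.norm_map]
    ring
  · simp [sgn, mul_comm]
  · simp only [mem_orbit, Equiv.prodComm_apply, Prod.fst_swap, Prod.snd_swap]
    tauto

variable {g : Plane → ℝ}

theorem ruleError_monomial_swap (hgr : ∀ x y : Plane, ‖x‖ = ‖y‖ → g x = g y) (a b : ℕ) :
    ruleError p α w (fun x => g x * (x 0 ^ a * x 1 ^ b)) h =
      ruleError p α w (fun x => g x * (x 0 ^ b * x 1 ^ a)) h := by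
  rw [← ruleError_comp_swapCoords]
  congr 1
  ext x
  simp only [Function.comp_apply, swapCoords_zero, swapCoords_one,
    hgr _ _ (swapCoords.norm_map x)]
  ring

/-- The reflection fixes the integrand's smooth factor but reverses the sign of the error. Together
with the swap, this one reflection also disposes of even exponents of `x 1`. -/
theorem ruleError_monomial_of_even (hgr : ∀ x y : Plane, ‖x‖ = ‖y‖ → g x = g y) {a : ℕ}
    (ha : Even a) (b : ℕ) : ruleError p α w (fun x => g x * (x 0 ^ a * x 1 ^ b)) h = 0 := by
  have h1 := ruleError_comp_reflectFst (p := p) (α := α) (w := w) (h := h)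
    (fun x => g x * (x 0 ^ a * x 1 ^ b))
  have h2 : (fun x => g x * (x 0 ^ a * x 1 ^ b)) ∘ reflectFst =
      fun x => g x * (x 0 ^ a * x 1 ^ b) := by
    ext x
    simp only [Function.comp_apply, reflectFst_zero, reflectFst_one,
      hgr _ _ (reflectFst.norm_map x), ha.neg_pow]
  rw [h2] at h1
  linarith

end Symmetry

/-! ### Error bounds for the corrected rule -/

theorem IsSymbol.abs_le_of_continuous {n M : ℕ} {B : ℝ} {φ : Plane → ℝ} (hB : IsSymbol n M B φ)
    (hφ : Continuous φ) (x : Plane) : |φ x| ≤ B * ‖x‖ ^ n := by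
  have hcl : IsClosed {x : Plane | |φ x| ≤ B * ‖x‖ ^ n} :=
    isClosed_le hφ.abs (continuous_const.mul (continuous_norm.pow n))
  have hsub : ({0}ᶜ : Set Plane) ⊆ {x : Plane | |φ x| ≤ B * ‖x‖ ^ n} := fun x hx => by
    simpa using hB.abs_le (x := x) hx
  exact hcl.closure_subset_iff.2 hsub (dense_compl_singleton (0 : Plane) x)

theorem exists_correction_bound {p : ℕ} (w : EuclideanSpace ℝ (idx p)) {φ : Plane → ℝ} {n : ℕ}
    {B : ℝ} (hB : ∀ x, |φ x| ≤ B * ‖x‖ ^ n) :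
    ∃ C : ℝ, ∀ h : ℝ, 0 < h → |correction p w φ h| ≤ C * h ^ n := by
  refine ⟨∑ γ : idx p, |w γ| * ∑ β ∈ orbit γ.1, |sgn β| * (B * ‖gridPt 1 β‖ ^ n), fun h hh => ?_⟩
  rw [correction, Finset.sum_mul]
  refine (Finset.abs_sum_le_sum_abs _ _).trans (Finset.sum_le_sum fun γ _ => ?_)
  rw [abs_mul, mul_assoc, Finset.sum_mul]
  refine mul_le_mul_of_nonneg_left ?_ (abs_nonneg _)
  refine (Finset.abs_sum_le_sum_abs _ _).trans (Finset.sum_le_sum fun β _ => ?_)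
  rw [abs_mul, mul_assoc]
  refine mul_le_mul_of_nonneg_left ((hB _).trans (le_of_eq ?_)) (abs_nonneg _)
  rw [gridPt_eq_smul, norm_smul, Real.norm_of_nonneg hh.le]
  ring

theorem exists_ruleError_bound {p : ℕ} {α : ℝ} (hα₀ : 0 < α) (hα₂ : α < 2)
    (w : EuclideanSpace ℝ (idx p)) {φ : Plane → ℝ} {n M : ℕ} {B : ℝ} (hB : IsSymbol n M B φ)
    (hM : n + 2 ≤ M) (hφ : Continuous φ) (hc : HasCompactSupport φ) :
    ∃ C : ℝ, ∀ h : ℝ, 0 < h → |ruleError p α w φ h| ≤ C * h ^ ((n : ℝ) + 2 - α) := by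
  obtain ⟨C₁, hC₁⟩ := exists_correction_bound w (hB.abs_le_of_continuous hφ)
  obtain ⟨A, hA⟩ := exists_isSymbol_kernel α M
  have hn : (0 : ℝ) ≤ n := n.cast_nonneg
  have hM' : (n : ℝ) + 2 ≤ M := by exact_mod_cast hM
  -- Since `α > 0`, `n + 2` derivatives already exceed the required `s + 2 = n + 2 - α`.
  obtain ⟨C₂, -, hC₂⟩ := exists_quadrature_bound (s := n + -α) (M := M) (by linarith) (by linarith)
  have hC₂ := hC₂ _ _ (hB.mul hA) hc.mul_right
  refine ⟨C₂ * (2 ^ M * B * A) + C₁, fun h hh => ?_⟩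
  have hpow : h ^ ((n : ℝ) + 2 - α) = h ^ (2 - α) * h ^ n := by
    rw [← Real.rpow_natCast, ← Real.rpow_add hh]; ring_nf
  rw [ruleError_eq, add_mul]
  refine (abs_add_le _ _).trans (add_le_add ?_ ?_)
  · refine (hC₂ h hh).trans (le_of_eq ?_)
    congr 2
    ring
  · rw [abs_mul, abs_of_nonneg (Real.rpow_nonneg hh.le _), hpow, mul_left_comm]
    exact mul_le_mul_of_nonneg_left (hC₁ h hh) (Real.rpow_nonneg hh.le _)

section Weights

variable {p : ℕ} {α : ℝ} {g : Plane → ℝ} {c : idx p → ℝ} {w : EuclideanSpace ℝ (idx p)}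

/-- The quadrature error is exactly `-h^(2-α+a+b)` times the right-hand side `c_ξ(h)`. By `K w = c`
the correction supplies the same power times `c_ξ`, up to the effect of `g - 1`; what remains gains
a factor `h^(2p)`. -/
theorem exists_ruleError_odd_monomial_bound (hg : ContDiff ℝ ∞ g) (hgc : HasCompactSupport g)
    (hg0 : g 0 = 1) (hgd : ∀ j : ℕ, 1 ≤ j → j < 2 * p → iteratedFDeriv ℝ j g 0 = 0)
    (hc : ∀ ξ, ∃ C : ℝ, ∀ h : ℝ, 0 < h → |rhs p α g h ξ - c ξ| ≤ C * h ^ (2 * p))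
    (hw : coeffK p *ᵥ w.ofLp = c) (ξ : idx p) :
    ∃ C : ℝ, ∀ h : ℝ, 0 < h → h ≤ 1 → |ruleError p α w
      (fun x => g x * (x 0 ^ (2 * ξ.1.1 - 1) * x 1 ^ (2 * ξ.1.2 - 1))) h| ≤
        C * h ^ (2 * (p : ℝ) + 2 - α) := by
  have hξ := mem_idx.1 ξ.2
  set a := 2 * ξ.1.1 - 1 with ha
  set b := 2 * ξ.1.2 - 1 with hb
  obtain ⟨C₁, hC₁⟩ := hc ξ
  obtain ⟨B, hB⟩ := exists_isSymbol_sub_one (n := 2 * p) le_rfl hg hgc hg0 hgd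
  have hgb : ∀ x, |(g x - 1) * (x 0 ^ a * x 1 ^ b)| ≤ B * ‖x‖ ^ (2 * p + (a + b)) := fun x => by
    rw [abs_mul, abs_mul, abs_pow, abs_pow, pow_add, pow_add, ← mul_assoc B]
    have := hB.abs_le_of_continuous (hg.continuous.sub continuous_const) x
    gcongr
    · exact (abs_nonneg _).trans this
    · exact abs_coord_le_norm x 0
    · exact abs_coord_le_norm x 1
  obtain ⟨C₂, hC₂⟩ := exists_correction_bound w hgb
  refine ⟨C₁ + C₂, fun h hh hh1 => ?_⟩
  have hmono : correction p w (fun x => x 0 ^ a * x 1 ^ b) h = h ^ (a + b) * c ξ := by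
    rw [← hw]
    simp only [correction, Matrix.mulVec, dotProduct, coeffK, Finset.mul_sum, Finset.sum_mul]
    refine Finset.sum_congr rfl fun γ _ => Finset.sum_congr rfl fun β _ => ?_
    simp only [gridPt, ← ha, ← hb, PiLp.toLp_apply, Matrix.cons_val_zero, Matrix.cons_val_one]
    ring
  have hcorr : correction p w (fun x => g x * (x 0 ^ a * x 1 ^ b)) h =
      h ^ (a + b) * c ξ + correction p w (fun x => (g x - 1) * (x 0 ^ a * x 1 ^ b)) h := by
    rw [← hmono]
    simp only [correction, ← Finset.sum_add_distrib, ← mul_add]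
    refine Finset.sum_congr rfl fun γ _ => ?_
    congr 1
    refine Finset.sum_congr rfl fun β _ => ?_
    ring
  have hpow : h ^ (2 * ((ξ.1.1 : ℝ) + ξ.1.2) - α) = h ^ (2 - α) * h ^ (a + b) := by
    rw [← Real.rpow_natCast, ← Real.rpow_add hh]
    congr 1
    rw [ha, hb]
    push_cast [Nat.cast_sub (by omega : 1 ≤ 2 * ξ.1.1), Nat.cast_sub (by omega : 1 ≤ 2 * ξ.1.2)]
    ring
  have hmoment : (fun x => g x * (x 0 ^ a * x 1 ^ b) * kernel α x) = moment α g ξ.1 := by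
    ext x
    simp only [moment, ← ha, ← hb]
    ring
  have hrhs : punctured h (fun x => g x * (x 0 ^ a * x 1 ^ b) * kernel α x) -
      ∫ x, g x * (x 0 ^ a * x 1 ^ b) * kernel α x =
        -(h ^ (2 - α) * h ^ (a + b) * rhs p α g h ξ) := by
    have h0 : h ^ (2 - α) * h ^ (a + b) ≠ 0 := by
      have := Real.rpow_pos_of_pos hh (2 - α)
      positivity
    rw [hmoment, rhs, hpow]
    field_simp
    ring
  have hid : ruleError p α w (fun x => g x * (x 0 ^ a * x 1 ^ b)) h =
      h ^ (2 - α) * (correction p w (fun x => (g x - 1) * (x 0 ^ a * x 1 ^ b)) h -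
        h ^ (a + b) * (rhs p α g h ξ - c ξ)) := by
    rw [ruleError_eq, hrhs, hcorr]
    ring
  have hsplit : h ^ (2 * (p : ℝ) + 2 - α) = h ^ (2 - α) * h ^ (2 * p) := by
    rw [← Real.rpow_natCast, ← Real.rpow_add hh]
    push_cast
    ring_nf
  have hα := Real.rpow_nonneg hh.le (2 - α)
  have hab : h ^ (a + b) ≤ 1 := pow_le_one₀ hh.le hh1
  have h1 := hC₁ h hh
  have h2 := hC₂ h hh
  rw [hid, abs_mul, abs_of_nonneg hα, hsplit, mul_left_comm]
  refine mul_le_mul_of_nonneg_left ?_ hα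
  refine (abs_sub _ _).trans ?_
  rw [abs_mul, abs_of_nonneg (pow_nonneg hh.le _), add_comm, add_mul]
  refine add_le_add ?_ ?_
  · calc _ ≤ 1 * |rhs p α g h ξ - c ξ| := by gcongr
      _ ≤ _ := by rw [one_mul]; exact h1
  · refine h2.trans ?_
    -- The sign of `C₂` is not given, so it is read off from the bound itself.
    have hC0 : 0 ≤ C₂ * h ^ (2 * p) := by
      have := (abs_nonneg _).trans h2
      have hp : 0 < h ^ (a + b) := pow_pos hh _
      rw [pow_add, ← mul_assoc] at this
      exact nonneg_of_mul_nonneg_left this hp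
    rw [pow_add, ← mul_assoc]
    exact mul_le_of_le_one_right hC0 hab

theorem exists_ruleError_monomial_bound (hg : ContDiff ℝ ∞ g) (hgc : HasCompactSupport g)
    (hgr : ∀ x y : Plane, ‖x‖ = ‖y‖ → g x = g y)
    (hg0 : g 0 = 1) (hgd : ∀ j : ℕ, 1 ≤ j → j < 2 * p → iteratedFDeriv ℝ j g 0 = 0)
    (hc : ∀ ξ, ∃ C : ℝ, ∀ h : ℝ, 0 < h → |rhs p α g h ξ - c ξ| ≤ C * h ^ (2 * p))
    (hw : coeffK p *ᵥ w.ofLp = c) {a b : ℕ} (hab : a + b < 2 * p) :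
    ∃ C : ℝ, ∀ h : ℝ, 0 < h → h ≤ 1 →
      |ruleError p α w (fun x => g x * (x 0 ^ a * x 1 ^ b)) h| ≤
        C * h ^ (2 * (p : ℝ) + 2 - α) := by
  wlog hba : b ≤ a generalizing a b
  · obtain ⟨C, hC⟩ := this (a := b) (b := a) (by omega) (by omega)
    refine ⟨C, fun h hh hh1 => ?_⟩
    rw [ruleError_monomial_swap hgr]
    exact hC h hh hh1
  rcases Nat.even_or_odd a with ha | ⟨m, rfl⟩
  · refine ⟨0, fun h hh hh1 => ?_⟩
    rw [ruleError_monomial_of_even hgr ha]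
    simp
  rcases Nat.even_or_odd b with hb | ⟨k, rfl⟩
  · refine ⟨0, fun h hh hh1 => ?_⟩
    rw [ruleError_monomial_swap hgr, ruleError_monomial_of_even hgr hb]
    simp
  have hmem : (m + 1, k + 1) ∈ idx p :=
    mem_idx.2 ⟨Nat.le_add_left 1 k, by dsimp only; omega, by dsimp only; omega⟩
  have := exists_ruleError_odd_monomial_bound hg hgc hg0 hgd hc hw ⟨_, hmem⟩
  simpa only [show 2 * (m + 1) - 1 = 2 * m + 1 by omega,
    show 2 * (k + 1) - 1 = 2 * k + 1 by omega] using this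

theorem exists_ruleError_polynomial_bound (hα₂ : α < 2) (hg : ContDiff ℝ ∞ g)
    (hgc : HasCompactSupport g) (hgr : ∀ x y : Plane, ‖x‖ = ‖y‖ → g x = g y)
    (hg0 : g 0 = 1) (hgd : ∀ j : ℕ, 1 ≤ j → j < 2 * p → iteratedFDeriv ℝ j g 0 = 0)
    (hc : ∀ ξ, ∃ C : ℝ, ∀ h : ℝ, 0 < h → |rhs p α g h ξ - c ξ| ≤ C * h ^ (2 * p))
    (hw : coeffK p *ᵥ w.ofLp = c) {P : Plane → ℝ} (hP : P ∈ polySpan (2 * p)) :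
    ∃ C : ℝ, ∀ h : ℝ, 0 < h → h ≤ 1 →
      |ruleError p α w (g * P) h| ≤ C * h ^ (2 * (p : ℝ) + 2 - α) := by
  induction hP using Submodule.span_induction with
  | mem P hP =>
    obtain ⟨a, b, hab, rfl⟩ := hP
    exact exists_ruleError_monomial_bound hg hgc hgr hg0 hgd hc hw hab
  | zero =>
    refine ⟨0, fun h _ _ => ?_⟩
    have := ruleError_smul (p := p) (α := α) (w := w) (φ := 0) (h := h) 0
    rw [zero_smul, zero_mul] at this
    rw [mul_zero, this]
    simp
  | add P Q hP hQ h1 h2 =>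
    obtain ⟨C₁, h1⟩ := h1
    obtain ⟨C₂, h2⟩ := h2
    refine ⟨C₁ + C₂, fun h hh hh1 => ?_⟩
    rw [mul_add, ruleError_add hα₂ (hg.continuous.mul (contDiff_of_mem_polySpan hP).continuous)
      hgc.mul_right (hg.continuous.mul (contDiff_of_mem_polySpan hQ).continuous) hgc.mul_right hh,
      add_mul]
    exact (abs_add_le _ _).trans (add_le_add (h1 h hh hh1) (h2 h hh hh1))
  | smul r P _ h1 =>
    obtain ⟨C₁, h1⟩ := h1
    refine ⟨|r| * C₁, fun h hh hh1 => ?_⟩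
    rw [mul_smul_comm, ruleError_smul, abs_mul, mul_assoc]
    exact mul_le_mul_of_nonneg_left (h1 h hh hh1) (abs_nonneg _)

theorem exists_corrected_error_bound (hα₀ : 0 < α) (hα₂ : α < 2) (hg : ContDiff ℝ ∞ g)
    (hgc : HasCompactSupport g) (hgr : ∀ x y : Plane, ‖x‖ = ‖y‖ → g x = g y)
    (hg0 : g 0 = 1) (hgd : ∀ j : ℕ, 1 ≤ j → j < 2 * p → iteratedFDeriv ℝ j g 0 = 0)
    (hc : ∀ ξ, ∃ C : ℝ, ∀ h : ℝ, 0 < h → |rhs p α g h ξ - c ξ| ≤ C * h ^ (2 * p))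
    (hw : coeffK p *ᵥ w.ofLp = c) {φ : Plane → ℝ} (hφ : ContDiff ℝ (2 * p + 2 : ℕ) φ)
    (hφc : HasCompactSupport φ) :
    ∃ C : ℝ, 0 < C ∧ ∀ h : ℝ, 0 < h →
      |ruleError p α w φ h| ≤ C * h ^ (2 * (p : ℝ) + 2 - α) := by
  obtain ⟨P, hP, B, hB⟩ := exists_remainder_isSymbol (n := 2 * p) (Nat.le_add_right _ 2) hg hgc hg0
    hgd hφ hφc
  have hPc := (contDiff_of_mem_polySpan hP).continuous
  have hRc : Continuous fun x => φ x - g x * P x := hφ.continuous.sub (hg.continuous.mul hPc)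
  have hRs : HasCompactSupport fun x => φ x - g x * P x := hφc.sub hgc.mul_right
  obtain ⟨C₁, hC₁⟩ := exists_ruleError_bound hα₀ hα₂ w hB le_rfl hRc hRs
  obtain ⟨C₂, hC₂⟩ := exists_ruleError_polynomial_bound hα₂ hg hgc hgr hg0 hgd hc hw hP
  obtain ⟨R, hR⟩ := exists_forall_norm_ge_eq_zero hφc
  obtain ⟨A, hA⟩ := exists_isSymbol_of_vanish (n := 0) (Nat.zero_le _) hφ hR (by simp)
  obtain ⟨C₃, hC₃⟩ := exists_ruleError_bound hα₀ hα₂ w hA (Nat.le_add_left _ _) hφ.continuous hφc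
  have hle : ∀ C ∈ ({C₁ + C₂, C₃} : Set ℝ), C ≤ |C₁ + C₂| + |C₃| + 1 := by
    rintro C (rfl | rfl)
    · linarith [le_abs_self (C₁ + C₂), abs_nonneg C₃]
    · linarith [le_abs_self C, abs_nonneg (C₁ + C₂)]
  refine ⟨|C₁ + C₂| + |C₃| + 1, by positivity, fun h hh => ?_⟩
  have hpos := Real.rpow_nonneg hh.le (2 * (p : ℝ) + 2 - α)
  rcases le_total h 1 with hh1 | hh1
  · refine le_trans ?_ (mul_le_mul_of_nonneg_right (hle (C₁ + C₂) (by simp)) hpos)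
    have hsplit : φ = (fun x => φ x - g x * P x) + g * P := by
      ext x
      simp
    rw [hsplit, ruleError_add hα₂ hRc hRs (hg.continuous.mul hPc) hgc.mul_right hh, add_mul]
    refine (abs_add_le _ _).trans (add_le_add ?_ (hC₂ h hh hh1))
    simpa using hC₁ h hh
  -- For `h ≥ 1`, treating `φ` as a symbol of order 0 gives `O(h^(2-α))`, which the larger power
  -- dominates.
  · refine (hC₃ h hh).trans ?_
    refine mul_le_mul (hle C₃ (by simp)) ?_ (Real.rpow_nonneg hh.le _) (by positivity)
    refine Real.rpow_le_rpow_of_exponent_le hh1 ?_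
    have : (0 : ℝ) ≤ p := p.cast_nonneg
    push_cast
    linarith

end Weights

/-! ### Convergence of the weights -/

theorem exists_rhs_limit {p : ℕ} (hp : 1 ≤ p) {α : ℝ} (hα₂ : α < 2) {g : Plane → ℝ}
    (hg : ContDiff ℝ ∞ g) (hgc : HasCompactSupport g) (hg0 : g 0 = 1)
    (hgd : ∀ j : ℕ, 1 ≤ j → j < 2 * p → iteratedFDeriv ℝ j g 0 = 0) (ξ : idx p) :
    ∃ c C : ℝ, ∀ h : ℝ, 0 < h → |rhs p α g h ξ - c| ≤ C * h ^ (2 * p) := by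
  have hξ := mem_idx.1 ξ.2
  set a := 2 * ξ.1.1 - 1 with ha
  set b := 2 * ξ.1.2 - 1 with hb
  have hab : (a : ℝ) + b - α + 2 = 2 * ((ξ.1.1 : ℝ) + ξ.1.2) - α := by
    rw [ha, hb]
    push_cast [Nat.cast_sub (by omega : 1 ≤ 2 * ξ.1.1), Nat.cast_sub (by omega : 1 ≤ 2 * ξ.1.2)]
    ring
  have hd : -2 < (a : ℝ) + b - α := by
    have : (0 : ℝ) ≤ a := a.cast_nonneg
    have : (0 : ℝ) ≤ b := b.cast_nonneg
    linarith
  obtain ⟨c, C, hC⟩ := exists_scaled_error_limit hd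
    ((contDiffOn_kernel α).mul
      (((contDiff_coord 0).pow a).mul ((contDiff_coord 1).pow b)).contDiffOn)
    (kernel_mul_monomial_smul α a b) hg hgc hg0 (by omega : 2 * p ≠ 0) hgd
  refine ⟨c, C, fun h hh => ?_⟩
  have hmoment : moment α g ξ.1 = fun x => g x * (kernel α x * (x 0 ^ a * x 1 ^ b)) := by
    ext x
    simp only [moment, ← ha, ← hb]
    ring
  have := hC h hh
  rwa [hab, Real.rpow_neg hh.le, ← one_div, ← hmoment] at this

theorem tendsto_comp_gridPt {f : Plane → ℝ} (hf : Continuous f) (β : ℤ × ℤ) :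
    Tendsto (fun h : ℝ => f (gridPt h β)) (𝓝[>] 0) (𝓝 (f 0)) := by
  have hc : Continuous fun h : ℝ => f (h • gridPt 1 β) := hf.comp (by fun_prop)
  have he : (fun h : ℝ => f (gridPt h β)) = fun h => f (h • gridPt 1 β) :=
    funext fun h => by rw [gridPt_eq_smul h]
  rw [he]
  simpa using (hc.tendsto 0).mono_left nhdsWithin_le_nhds

theorem solves_iff {p : ℕ} {α : ℝ} {g : Plane → ℝ} {h : ℝ} {w : EuclideanSpace ℝ (idx p)} :
    Solves p α g h w ↔ ∀ γ : idx p, g (gridPt h ((γ.1.1 : ℤ), (γ.1.2 : ℤ))) * w γ =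
      ((coeffK p)⁻¹ *ᵥ rhs p α g h) γ := by
  have hdet : IsUnit (coeffK p).det := (coeffK_det_ne_zero p).isUnit
  have hD : ∀ γ, (diagG p g h *ᵥ w.ofLp) γ =
      g (gridPt h ((γ.1.1 : ℤ), (γ.1.2 : ℤ))) * w γ := fun γ => Matrix.mulVec_diagonal _ _ _
  simp only [← hD]
  rw [Solves, ← Matrix.mulVec_mulVec, ← funext_iff]
  constructor
  · intro h
    rw [← h, Matrix.mulVec_mulVec, Matrix.nonsing_inv_mul _ hdet, Matrix.one_mulVec]
  · intro h
    rw [h, Matrix.mulVec_mulVec, Matrix.mul_nonsing_inv _ hdet, Matrix.one_mulVec]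

theorem eventually_existsUnique_solves {p : ℕ} {α : ℝ} {g : Plane → ℝ} (hg : Continuous g)
    (hg0 : g 0 = 1) : ∀ᶠ h in 𝓝[>] (0 : ℝ), ∃! w : EuclideanSpace ℝ (idx p), Solves p α g h w := by
  have hne : ∀ᶠ h in 𝓝[>] (0 : ℝ), ∀ γ : idx p, g (gridPt h ((γ.1.1 : ℤ), (γ.1.2 : ℤ))) ≠ 0 :=
    eventually_all.2 fun γ =>
      (tendsto_comp_gridPt hg _).eventually_ne (by rw [hg0]; exact one_ne_zero)
  filter_upwards [hne] with h hh
  refine ⟨WithLp.toLp 2 fun γ => (g (gridPt h ((γ.1.1 : ℤ), (γ.1.2 : ℤ))))⁻¹ *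
    ((coeffK p)⁻¹ *ᵥ rhs p α g h) γ, solves_iff.2 fun γ => mul_inv_cancel_left₀ (hh γ) _, ?_⟩
  intro w hw
  ext γ
  have hwγ : _ = ((coeffK p)⁻¹ *ᵥ rhs p α g h) γ := solves_iff.1 hw γ
  simp only [← hwγ, inv_mul_cancel_left₀ (hh γ)]

theorem isBigO_solution_sub {p : ℕ} {α : ℝ} {g : Plane → ℝ} (hg : ContDiff ℝ ∞ g)
    (hgc : HasCompactSupport g) (hg0 : g 0 = 1)
    (hgd : ∀ j : ℕ, 1 ≤ j → j < 2 * p → iteratedFDeriv ℝ j g 0 = 0) {c : idx p → ℝ}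
    (hc : ∀ ξ, ∃ C : ℝ, ∀ h : ℝ, 0 < h → |rhs p α g h ξ - c ξ| ≤ C * h ^ (2 * p))
    {w : ℝ → EuclideanSpace ℝ (idx p)} (hw : ∀ᶠ h in 𝓝[>] (0 : ℝ), Solves p α g h (w h)) :
    (fun h => w h - WithLp.toLp 2 ((coeffK p)⁻¹ *ᵥ c)) =O[𝓝[>] 0] fun h : ℝ => h ^ (2 * p) := by
  refine ((PiLp.continuousLinearEquiv 2 ℝ fun _ : idx p => ℝ).isBigO_comp_rev _ _).trans
    (Asymptotics.isBigO_pi.2 fun γ => ?_)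
  have hrhs : ∀ ξ, (fun h => rhs p α g h ξ - c ξ) =O[𝓝[>] 0] fun h : ℝ => h ^ (2 * p) := by
    intro ξ
    obtain ⟨C, hC⟩ := hc ξ
    refine Asymptotics.IsBigO.of_bound C ?_
    filter_upwards [self_mem_nhdsWithin] with h hh
    rw [Real.norm_eq_abs, Real.norm_of_nonneg (pow_nonneg (le_of_lt hh) _)]
    exact hC h hh
  have hg1 : (fun h => g (gridPt h ((γ.1.1 : ℤ), (γ.1.2 : ℤ))) - 1) =O[𝓝[>] 0]
      fun h : ℝ => h ^ (2 * p) := by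
    obtain ⟨B, hB⟩ := exists_isSymbol_sub_one (n := 2 * p) le_rfl hg hgc hg0 hgd
    refine Asymptotics.IsBigO.of_bound (B * ‖gridPt 1 ((γ.1.1 : ℤ), (γ.1.2 : ℤ))‖ ^ (2 * p)) ?_
    filter_upwards [self_mem_nhdsWithin] with h hh
    refine (hB.abs_le_of_continuous (hg.continuous.sub continuous_const) _).trans (le_of_eq ?_)
    rw [gridPt_eq_smul, norm_smul, norm_pow]
    ring
  have hinv : (fun h => (g (gridPt h ((γ.1.1 : ℤ), (γ.1.2 : ℤ))))⁻¹) =O[𝓝[>] 0]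
      fun _ : ℝ => (1 : ℝ) := by
    refine Tendsto.isBigO_one (c := (1 : ℝ)⁻¹) ℝ ?_
    have := tendsto_comp_gridPt hg.continuous ((γ.1.1 : ℤ), (γ.1.2 : ℤ))
    rw [hg0] at this
    exact this.inv₀ one_ne_zero
  -- With `ω̄ = K⁻¹ c`, the difference `ω(h) - ω̄` at `γ` is this numerator divided by `g(γh)`,
  -- whose inverse stays bounded.
  have hnum : (fun h => ∑ ξ, (coeffK p)⁻¹ γ ξ * (rhs p α g h ξ - c ξ) -
      ((coeffK p)⁻¹ *ᵥ c) γ * (g (gridPt h ((γ.1.1 : ℤ), (γ.1.2 : ℤ))) - 1)) =O[𝓝[>] 0]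
      fun h : ℝ => h ^ (2 * p) :=
    (Asymptotics.IsBigO.fun_sum fun ξ _ => (hrhs ξ).const_mul_left _).sub (hg1.const_mul_left _)
  refine ((hinv.mul hnum).congr' ?_ (by simp)).trans (Asymptotics.isBigO_refl _ _)
  have hne : ∀ᶠ h in 𝓝[>] (0 : ℝ), g (gridPt h ((γ.1.1 : ℤ), (γ.1.2 : ℤ))) ≠ 0 :=
    (tendsto_comp_gridPt hg.continuous _).eventually_ne (by rw [hg0]; exact one_ne_zero)
  filter_upwards [hw, hne] with h hwh hh
  have hsol := solves_iff.1 hwh γ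
  have hsum : ∑ ξ, (coeffK p)⁻¹ γ ξ * (rhs p α g h ξ - c ξ) =
      ((coeffK p)⁻¹ *ᵥ rhs p α g h) γ - ((coeffK p)⁻¹ *ᵥ c) γ := by
    simp only [Matrix.mulVec, dotProduct, mul_sub, Finset.sum_sub_distrib]
  rw [hsum, ← hsol]
  simp only [PiLp.continuousLinearEquiv_apply, WithLp.ofLp_sub, Pi.sub_apply]
  field_simp
  ring

end OffDiag

theorem theorem3p8 (p : ℕ) (hp : 1 ≤ p) (α : ℝ) (hα₀ : 0 < α) (hα₂ : α < 2)
    (g : OffDiag.Plane → ℝ) (hg : ContDiff ℝ ∞ g) (hgc : HasCompactSupport g)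
    (hgr : ∀ x y : OffDiag.Plane, ‖x‖ = ‖y‖ → g x = g y) (hg0 : g 0 = 1)
    (hgd : ∀ j : ℕ, 1 ≤ j → j ≤ 2 * p - 1 → iteratedFDeriv ℝ j g 0 = 0) :
    (∀ᶠ h in 𝓝[>] (0 : ℝ), ∃! w : EuclideanSpace ℝ (OffDiag.idx p), OffDiag.Solves p α g h w) ∧
    ∃ wbar : EuclideanSpace ℝ (OffDiag.idx p),
      (∀ w : ℝ → EuclideanSpace ℝ (OffDiag.idx p),
        (∀ᶠ h in 𝓝[>] (0 : ℝ), OffDiag.Solves p α g h (w h)) →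
          Tendsto w (𝓝[>] 0) (𝓝 wbar) ∧
          (fun h => w h - wbar) =O[𝓝[>] 0] fun h : ℝ => h ^ (2 * p)) ∧
      ∀ (N : ℕ) (_ : 2 * p + 2 ≤ N) (φ : OffDiag.Plane → ℝ) (_ : ContDiff ℝ N φ)
        (_ : HasCompactSupport φ),
        Integrable (fun x => φ x * OffDiag.kernel α x) volume ∧
        ∃ C : ℝ, 0 < C ∧ ∀ h : ℝ, 0 < h →
          |OffDiag.corrected p α wbar φ h - ∫ x, φ x * OffDiag.kernel α x| ≤
            C * h ^ (2 * (p : ℝ) + 2 - α) := by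
  have hgd' : ∀ j : ℕ, 1 ≤ j → j < 2 * p → iteratedFDeriv ℝ j g 0 = 0 := fun j h1 h2 =>
    hgd j h1 (by omega)
  choose c hc using OffDiag.exists_rhs_limit hp hα₂ hg hgc hg0 hgd'
  refine ⟨OffDiag.eventually_existsUnique_solves hg.continuous hg0,
    WithLp.toLp 2 ((OffDiag.coeffK p)⁻¹ *ᵥ c), fun w hw => ?_, fun N hN φ hφ hφc => ?_⟩
  · have hO := OffDiag.isBigO_solution_sub hg hgc hg0 hgd' hc hw
    have hlim : Tendsto (fun h : ℝ => h ^ (2 * p)) (𝓝[>] 0) (𝓝 0) := by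
      have := (continuous_pow (M := ℝ) (2 * p)).tendsto 0
      rw [zero_pow (by omega)] at this
      exact this.mono_left nhdsWithin_le_nhds
    exact ⟨tendsto_sub_nhds_zero_iff.1 (hO.trans_tendsto hlim), hO⟩
  · refine ⟨OffDiag.integrable_mul_kernel hα₂ hφ.continuous hφc, ?_⟩
    refine OffDiag.exists_corrected_error_bound hα₀ hα₂ hg hgc hgr hg0 hgd' hc ?_
      (hφ.of_le (by exact_mod_cast hN)) hφc
    rw [Matrix.mulVec_mulVec,
      Matrix.mul_nonsing_inv _ (OffDiag.coeffK_det_ne_zero p).isUnit, Matrix.one_mulVec]
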